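/- Let packets arrive at a single-server first-come-first-served queue, empty at time $0$, with integer inter-arrival times $X_0,X_1,\dots$ and integer service times $S_0,S_1,\dots$, all mutually independent. The $X_k$ are identically distributed (as $X$) with $\Pr\{X=0\}=0$ and $E(X^2)<\infty$, and the $S_k$ are distributed as $S$, geometric with parameter $\mu\in(0,1)$: $\Pr\{S=n\}=(1-\mu)^{n-1}\mu$ for $n\ge1$. Assume $\rho=E(S)/E(X)<1$. Packet $k$ arrives at $n_k=X_0+\dots+X_k$ and departs at $n_k'=n_k+T_k$, where $T_0=S_0$ and $T_{k}=\max\{T_{k-1}-X_{k},0\}+S_{k}$ for $k\ge1$. The age of information at time $t\ge0$ is $\Delta(t)=t-U(t)$, where $U(t)$ is the arrival epoch of the latest packet that has departed by time $t$ ($U(t)=0$ if there is none), and the average age of information is the normalized area under the age curve, $$\bar\Delta=\lim_{N\to\infty}\frac1N\int_0^N\Delta(t)\,dt .$$ Put $G_X(z)=E(z^X)$ and $$\widehat G_X^{'1}(z)=\frac{E(X)}{z},\qquad \widehat G_X^{'2}(z)=\frac{E(X)+\ln(z)\,E(X^2)}{z}.$$ Then the equation $z=G_X(1-\mu+\mu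 z)$ has exactly one root $\alpha$ in $(0,1)$; with $\lambda=1-\mu+\mu\alpha$, the limit $\bar\Delta$ exists almost surely, is almost surely equal to a constant, and satisfies $$\bar\Delta<E(S)+\frac{E(X^2)}{2E(X)}+\frac{\lambda\,\min\{E(S),\widehat G_X^{'1}(\lambda)\}}{E(X)(1-\lambda)},$$ $$\bar\Delta>E(S)+\frac{E(X^2)}{2E(X)}+\frac{\lambda\,\max\{\alpha/\lambda,\widehat G_X^{'2}(\lambda)\}}{E(X)(1-\lambda)}.$$ -/

import Mathlib

open MeasureTheory ProbabilityTheory Filter Topology Set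

/-- Arrival epoch `n_k = X_0 + ⋯ + X_k` of packet `k` (`k = 0, 1, …`) when the inter-arrival
times are `x k`; the clock starts at `0`. -/
def arrivalEpoch (x : ℕ → ℕ) (k : ℕ) : ℕ := ∑ i ∈ Finset.range (k + 1), x i

/-- System time `T_k = W_k + S_k` of packet `k` in the single-server first-come-first-served queue
with inter-arrival times `x` and service times `s`, initially empty. The waiting time is
`W_0 = 0`, `W_{k+1} = max (T_k - X_{k+1}) 0` (truncated subtraction in `ℕ`). -/
def systemTime (x s : ℕ → ℕ) : ℕ → ℕ
  | 0 => s 0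
  | k + 1 => (systemTime x s k - x (k + 1)) + s (k + 1)

/-- Departure (delivery) epoch `n'_k = n_k + T_k` of packet `k`. -/
def departureEpoch (x s : ℕ → ℕ) (k : ℕ) : ℕ := arrivalEpoch x k + systemTime x s k

/-- `U(t)`: arrival epoch of the latest packet delivered by time `t`
(`0` as long as nothing has been delivered; the set is bounded above by `t`). -/
noncomputable def latestReceived (x s : ℕ → ℕ) (t : ℝ) : ℕ :=
  sSup {a : ℕ | ∃ k : ℕ, a = arrivalEpoch x k ∧ (departureEpoch x s k : ℝ) ≤ t}

/-- Age of information `Δ(t) = t - U(t)`. -/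
noncomputable def ageOfInformation (x s : ℕ → ℕ) (t : ℝ) : ℝ := t - (latestReceived x s t : ℝ)

/-- The average age of information along one sample path exists and equals `Δ`: the area under the
age curve over the first `N` blocks, divided by `N`, tends to `Δ`. -/
def HasAverageAge (x s : ℕ → ℕ) (Δ : ℝ) : Prop :=
  Tendsto (fun N : ℕ => (∫ t in (0 : ℝ)..(N : ℝ), ageOfInformation x s t) / (N : ℝ)) atTop (𝓝 Δ)

/-- The `n`-th moment `E(Y^n)` of an `ℕ`-valued random variable. -/
noncomputable def natMoment {Ω : Type*} [MeasurableSpace Ω] (P : Measure Ω) (Y : Ω → ℕ) (n : ℕ) :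
    ℝ := ∫ ω, (Y ω : ℝ) ^ n ∂P

/-- The probability generating function `G_Y(z) = E(z^Y)`, for `z ∈ [0, 1]`. -/
noncomputable def probGenFun {Ω : Type*} [MeasurableSpace Ω] (P : Measure Ω) (Y : Ω → ℕ) (z : ℝ) :
    ℝ := ∫ ω, z ^ (Y ω) ∂P

/-- The `K`-term moment estimate of `G_Y'(z)`:
`(1 / z) ∑_{n = 1}^K (ln z)^{n-1} E(Y^n) / (n-1)!`. -/
noncomputable def pgfDerivEstimate {Ω : Type*} [MeasurableSpace Ω] (P : Measure Ω) (Y : Ω → ℕ)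
    (K : ℕ) (z : ℝ) : ℝ :=
  (1 / z) * ∑ n ∈ Finset.Icc 1 K,
    Real.log z ^ (n - 1) * natMoment P Y n / (Nat.factorial (n - 1) : ℝ)

/-- The expression `E(S) + E(X²) / (2 E(X)) + l g / (E(X) (1 - l))`. -/
noncomputable def ageExpression {Ω : Type*} [MeasurableSpace Ω] (P : Measure Ω) (X S : Ω → ℕ)
    (l g : ℝ) : ℝ :=
  natMoment P S 1 + natMoment P X 2 / (2 * natMoment P X 1)
    + l * g / (natMoment P X 1 * (1 - l))

/-! The average age has a closed form: it is `E(S) + E(X²)/(2E(X)) + E(X λ^X)/(E(X)(1-λ))`, and the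
stated bounds are elementary estimates of `E(X λ^X) = λ G_X'(λ)`.

Between departures the age grows linearly, so its area up to departure `K` is `∑ (X_k T_k + X_k²/2)`
up to boundary terms (`integral_age_departureEpoch`). Dividing by the elapsed time, which is
asymptotic to `K E(X)`, leaves the limit of the averages of `X_{k+1} T_{k+1} = X_{k+1} (T_k -
X_{k+1})⁺ + X_{k+1} S_{k+1}`. The second summand obeys the strong law. The first is an additive
functional of the Markov chain `T`, and its ergodic theorem is proved by hand. A solution `H` of the
Poisson equation (`exists_poisson_solution`) turns the centred sum into a martingale plus `H(T_0) -
H(T_n)`; a geometric drift bounds second moments, so Borel–Cantelli along the squares and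
monotonicity give almost sure convergence to the Poisson constant `y` (`ae_tendsto_of_poisson`).

To find `y`, the Poisson equation is averaged over the invariant law of `T`, which is geometric with
ratio `λ` (`geoExpect_invariant`): the `H` terms cancel, leaving `y = E(X λ^X)/(1-λ)`
(`poisson_constant_eq`).

The root, the drift and one upper bound all come from the chord slope `c(w) = (1 - G_X(w))/(1 - w)`.
The equation for `α` reads `μ c(λ) = 1`, and `c` is continuous and strictly increasing with `c(1) =
E(X) > 1/μ`. The drift condition at rate `1/β` is `μ c(β) > 1`, true for `β > λ`. The bounds compare
integrands termwise; they are strict because `ρ < 1` forces `E(X) > 1`, hence `P(X ≥ 2) > 0`. -/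

/-! ### Sample paths: the area under the age curve. -/

theorem arrivalEpoch_succ (x : ℕ → ℕ) (k : ℕ) :
    arrivalEpoch x (k + 1) = arrivalEpoch x k + x (k + 1) := by
  simp [arrivalEpoch, Finset.sum_range_succ _ (k + 1)]

theorem arrivalEpoch_mono (x : ℕ → ℕ) : Monotone (arrivalEpoch x) :=
  monotone_nat_of_le_succ fun k => by rw [arrivalEpoch_succ]; omega

theorem departureEpoch_succ_ge (x s : ℕ → ℕ) (k : ℕ) :
    departureEpoch x s k + s (k + 1) ≤ departureEpoch x s (k + 1) := by
  simp only [departureEpoch, arrivalEpoch_succ, systemTime]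
  omega

theorem departureEpoch_strictMono (x : ℕ → ℕ) {s : ℕ → ℕ} (hs : ∀ k, 1 ≤ s k) :
    StrictMono (departureEpoch x s) :=
  strictMono_nat_of_lt_succ fun k => by
    have := departureEpoch_succ_ge x s k
    have := hs (k + 1)
    omega

/-- No packet leaves before it arrives. Boundedness matters because `sSup` of an unbounded set in
`ℕ` defaults to `0`. -/
theorem bddAbove_received (x s : ℕ → ℕ) (t : ℝ) :
    BddAbove {a : ℕ | ∃ k : ℕ, a = arrivalEpoch x k ∧ (departureEpoch x s k : ℝ) ≤ t} := by
  refine ⟨⌊t⌋₊, ?_⟩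
  rintro a ⟨k, rfl, hk⟩
  refine Nat.le_floor (le_trans ?_ hk)
  simp [departureEpoch]

theorem latestReceived_mono (x s : ℕ → ℕ) : Monotone (latestReceived x s) := by
  intro t u htu
  unfold latestReceived
  rcases Set.eq_empty_or_nonempty
    {a : ℕ | ∃ k : ℕ, a = arrivalEpoch x k ∧ (departureEpoch x s k : ℝ) ≤ t} with h | h
  · rw [h]; simp
  · refine csSup_le_csSup (bddAbove_received x s u) h ?_
    rintro a ⟨k, rfl, hk⟩
    exact ⟨k, rfl, hk.trans htu⟩

theorem latestReceived_le (x s : ℕ → ℕ) {t : ℝ} (ht : 0 ≤ t) : (latestReceived x s t : ℝ) ≤ t := by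
  unfold latestReceived
  rcases Set.eq_empty_or_nonempty
    {a : ℕ | ∃ k : ℕ, a = arrivalEpoch x k ∧ (departureEpoch x s k : ℝ) ≤ t} with h | h
  · rw [h]; simpa using ht
  · obtain ⟨k, hk, hkt⟩ := Nat.sSup_mem h (bddAbove_received x s t)
    rw [hk]
    refine le_trans ?_ hkt
    simp [departureEpoch]

theorem latestReceived_of_lt_first (x : ℕ → ℕ) {s : ℕ → ℕ} (hs : ∀ k, 1 ≤ s k) {t : ℝ}
    (ht : t < departureEpoch x s 0) : latestReceived x s t = 0 := by
  unfold latestReceived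
  have : {a : ℕ | ∃ k : ℕ, a = arrivalEpoch x k ∧ (departureEpoch x s k : ℝ) ≤ t} = ∅ := by
    ext a
    simp only [mem_ofPred_eq, mem_empty_iff_false, iff_false, not_exists, not_and, not_le]
    intro k _
    have : departureEpoch x s 0 ≤ departureEpoch x s k :=
      (departureEpoch_strictMono x hs).monotone (Nat.zero_le k)
    exact ht.trans_le (by exact_mod_cast this)
  rw [this]; simp

theorem latestReceived_of_mem_Ico (x : ℕ → ℕ) {s : ℕ → ℕ} (hs : ∀ k, 1 ≤ s k) {k : ℕ} {t : ℝ}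
    (h1 : (departureEpoch x s k : ℝ) ≤ t) (h2 : t < departureEpoch x s (k + 1)) :
    latestReceived x s t = arrivalEpoch x k := by
  unfold latestReceived
  refine le_antisymm (csSup_le ⟨_, k, rfl, h1⟩ ?_)
    (le_csSup (bddAbove_received x s t) ⟨k, rfl, h1⟩)
  rintro a ⟨j, rfl, hj⟩
  have : (departureEpoch x s j : ℝ) < departureEpoch x s (k + 1) := hj.trans_lt h2
  have := (departureEpoch_strictMono x hs).lt_iff_lt.1 (by exact_mod_cast this)
  exact arrivalEpoch_mono x (by omega)

theorem ageOfInformation_nonneg (x s : ℕ → ℕ) {t : ℝ} (ht : 0 ≤ t) : 0 ≤ ageOfInformation x s t :=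
  sub_nonneg.2 (latestReceived_le x s ht)

theorem intervalIntegrable_ageOfInformation (x s : ℕ → ℕ) (a b : ℝ) :
    IntervalIntegrable (ageOfInformation x s) volume a b := by
  unfold ageOfInformation
  refine intervalIntegral.intervalIntegrable_id.sub ?_
  exact Monotone.intervalIntegrable fun t u htu => by
    exact_mod_cast latestReceived_mono x s htu

theorem intervalIntegral_sub_const (a b c : ℝ) :
    ∫ t in a..b, (t - c) = ((b - c) ^ 2 - (a - c) ^ 2) / 2 := by
  rw [intervalIntegral.integral_sub intervalIntegral.intervalIntegrable_id
    intervalIntegrable_const]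
  simp only [integral_id, intervalIntegral.integral_const, smul_eq_mul]
  ring

theorem integral_age_first (x : ℕ → ℕ) {s : ℕ → ℕ} (hs : ∀ k, 1 ≤ s k) :
    ∫ t in (0 : ℝ)..(departureEpoch x s 0), ageOfInformation x s t
      = (departureEpoch x s 0 : ℝ) ^ 2 / 2 := by
  have h := intervalIntegral_sub_const 0 (departureEpoch x s 0) 0
  simp only [sub_zero] at h
  rw [show (departureEpoch x s 0 : ℝ) ^ 2 / 2 = ((departureEpoch x s 0 : ℝ) ^ 2 - 0 ^ 2) / 2 by
    ring, ← h]
  refine intervalIntegral.integral_congr_Ioo_of_le (by positivity) fun t ht => ?_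
  simp [ageOfInformation, latestReceived_of_lt_first x hs ht.2]

/-- Between these departures the age is `t - n_k`, rising from `T_k` to `X_{k+1} + T_{k+1}`, so the
area is a difference of two triangles. -/
theorem integral_age_step (x : ℕ → ℕ) {s : ℕ → ℕ} (hs : ∀ k, 1 ≤ s k) (k : ℕ) :
    ∫ t in (departureEpoch x s k : ℝ)..(departureEpoch x s (k + 1)), ageOfInformation x s t
      = ((x (k + 1) : ℝ) + systemTime x s (k + 1)) ^ 2 / 2 - (systemTime x s k : ℝ) ^ 2 / 2 := by
  have h := intervalIntegral_sub_const (departureEpoch x s k) (departureEpoch x s (k + 1))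
    (arrivalEpoch x k)
  have e : ((x (k + 1) : ℝ) + systemTime x s (k + 1)) ^ 2 / 2 - (systemTime x s k : ℝ) ^ 2 / 2
      = (((departureEpoch x s (k + 1) : ℝ) - arrivalEpoch x k) ^ 2
        - ((departureEpoch x s k : ℝ) - arrivalEpoch x k) ^ 2) / 2 := by
    simp only [departureEpoch, arrivalEpoch_succ]
    push_cast
    ring
  rw [e, ← h]
  refine intervalIntegral.integral_congr_Ioo_of_le ?_ fun t ht => ?_
  · exact_mod_cast ((departureEpoch_strictMono x hs).monotone (Nat.le_succ k))
  · simp [ageOfInformation, latestReceived_of_mem_Ico x hs ht.1.le ht.2]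

/-- Expanding the square in each step leaves `(T_{k+1}² - T_k²)/2`, which telescopes. -/
theorem integral_age_departureEpoch (x : ℕ → ℕ) {s : ℕ → ℕ} (hs : ∀ k, 1 ≤ s k) (K : ℕ) :
    ∫ t in (0 : ℝ)..(departureEpoch x s K), ageOfInformation x s t
      = (departureEpoch x s 0 : ℝ) ^ 2 / 2
        + ∑ k ∈ Finset.range K,
          ((x (k + 1) : ℝ) * systemTime x s (k + 1) + (x (k + 1) : ℝ) ^ 2 / 2)
        + ((systemTime x s K : ℝ) ^ 2 - (systemTime x s 0 : ℝ) ^ 2) / 2 := by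
  induction K with
  | zero => rw [integral_age_first x hs]; simp
  | succ K ih =>
    rw [← intervalIntegral.integral_add_adjacent_intervals
      (intervalIntegrable_ageOfInformation x s 0 (departureEpoch x s K))
      (intervalIntegrable_ageOfInformation x s _ _), ih, integral_age_step x hs,
      Finset.sum_range_succ]
    ring

theorem integral_age_mono (x s : ℕ → ℕ) {a b : ℝ} (ha : 0 ≤ a) (hab : a ≤ b) :
    ∫ t in (0 : ℝ)..a, ageOfInformation x s t ≤ ∫ t in (0 : ℝ)..b, ageOfInformation x s t := by
  rw [← intervalIntegral.integral_add_adjacent_intervals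
      (intervalIntegrable_ageOfInformation x s 0 a)
      (intervalIntegrable_ageOfInformation x s a b)]
  have := intervalIntegral.integral_nonneg (μ := volume) hab
    fun t (ht : t ∈ Icc a b) => ageOfInformation_nonneg x s (ha.trans ht.1)
  linarith

/-! ### From averages over packets to averages over time. -/

/-- Renewal-type passage from averages along a strictly increasing sequence of epochs to time
averages. -/
theorem tendsto_div_of_tendsto_epochs {F : ℕ → ℝ} (hF : Monotone F) (hF0 : ∀ n, 0 ≤ F n)
    {d : ℕ → ℕ} (hd : StrictMono d) {a m : ℝ} (hm : 0 < m)
    (hFd : Tendsto (fun K : ℕ => F (d K) / K) atTop (𝓝 a))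
    (hdm : Tendsto (fun K : ℕ => (d K : ℝ) / K) atTop (𝓝 m)) :
    Tendsto (fun N : ℕ => F N / N) atTop (𝓝 (a / m)) := by
  have hex : ∀ N : ℕ, ∃ k, N < d (k + 1) := fun N => ⟨N, hd.le_apply⟩
  -- For large `N`, `κ N` is the index with `d (κ N) ≤ N < d (κ N + 1)`. The lower inequality can
  -- fail only when `κ N = 0`. Monotonicity then squeezes `F N / N` between `F (d κ) / d (κ + 1)`
  -- and `F (d (κ + 1)) / d κ`.
  set κ : ℕ → ℕ := fun N => Nat.find (hex N) with hκ
  have hκ1 : ∀ N, N < d (κ N + 1) := fun N => Nat.find_spec (hex N)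
  have hκtop : Tendsto κ atTop atTop := by
    refine tendsto_atTop.2 fun b => ?_
    filter_upwards [eventually_ge_atTop (d (b + 1))] with N hN
    by_contra h
    have h2 := hd.monotone (show κ N + 1 ≤ b + 1 by omega)
    have := hκ1 N
    omega
  have hκ2 : ∀ᶠ N in atTop, d (κ N) ≤ N := by
    filter_upwards [hκtop.eventually_ge_atTop 1] with N hN
    have := Nat.find_min (hex N) (show κ N - 1 < κ N by omega)
    rw [show κ N - 1 + 1 = κ N by omega] at this
    omega
  have hshift : Tendsto (fun K : ℕ => ((K + 1 : ℕ) : ℝ) / K) atTop (𝓝 1) := by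
    have h := (tendsto_const_nhds (x := (1 : ℝ))).add tendsto_one_div_atTop_nhds_zero_nat
    rw [add_zero] at h
    refine h.congr' ?_
    filter_upwards [eventually_gt_atTop 0] with K hK
    have : (K : ℝ) ≠ 0 := by positivity
    push_cast
    field_simp
  have hdpos : ∀ K, 0 < K → 0 < d K := fun K hK => lt_of_le_of_lt (Nat.zero_le _) (hd hK)
  have hup : Tendsto (fun K : ℕ => F (d (K + 1)) / d K) atTop (𝓝 (a / m)) := by
    have h := (((hFd.comp (tendsto_add_atTop_nat 1)).mul hshift).div hdm hm.ne')
    rw [mul_one] at h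
    refine h.congr' ?_
    filter_upwards [eventually_gt_atTop 0] with K hK
    have h1 : (K : ℝ) ≠ 0 := by positivity
    have h2 : (d K : ℝ) ≠ 0 := by have := hdpos K hK; positivity
    have h3 : ((K + 1 : ℕ) : ℝ) ≠ 0 := by positivity
    simp only [Function.comp, Pi.div_apply]
    field_simp
  have hlo : Tendsto (fun K : ℕ => F (d K) / d (K + 1)) atTop (𝓝 (a / m)) := by
    have h := (hFd.div ((hdm.comp (tendsto_add_atTop_nat 1)).mul hshift) (by simpa using hm.ne'))
    rw [mul_one] at h
    refine h.congr' ?_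
    filter_upwards [eventually_gt_atTop 0] with K hK
    have h1 : (K : ℝ) ≠ 0 := by positivity
    have h2 : (d (K + 1) : ℝ) ≠ 0 := by have := hdpos (K + 1) (by omega); positivity
    have h3 : ((K + 1 : ℕ) : ℝ) ≠ 0 := by positivity
    simp only [Function.comp, Pi.div_apply]
    field_simp
  refine tendsto_of_tendsto_of_tendsto_of_le_of_le' (hlo.comp hκtop) (hup.comp hκtop) ?_ ?_
  · filter_upwards [hκ2, eventually_gt_atTop 0] with N hN hN0
    have h1 : (N : ℝ) ≤ d (κ N + 1) := by exact_mod_cast (hκ1 N).le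
    exact div_le_div₀ (hF0 _) (hF hN) (by exact_mod_cast hN0) h1
  · filter_upwards [hκ2, hκtop.eventually_gt_atTop 0] with N hN hN0
    have h1 : (d (κ N) : ℝ) ≤ N := by exact_mod_cast hN
    exact div_le_div₀ (hF0 _) (hF (hκ1 N).le) (by exact_mod_cast hdpos _ hN0) h1

theorem hasAverageAge_of_tendsto {x s : ℕ → ℕ} (hs : ∀ k, 1 ≤ s k) {a m : ℝ} (hm : 0 < m)
    (hx : Tendsto (fun n : ℕ => (∑ k ∈ Finset.range n, (x k : ℝ)) / n) atTop (𝓝 m))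
    (hT : Tendsto (fun n : ℕ => (systemTime x s n : ℝ) ^ 2 / n) atTop (𝓝 0))
    (hxT : Tendsto (fun n : ℕ => (∑ k ∈ Finset.range n,
      ((x (k + 1) : ℝ) * systemTime x s (k + 1) + (x (k + 1) : ℝ) ^ 2 / 2)) / (n : ℝ)) atTop (𝓝 a)) :
    HasAverageAge x s (a / m) := by
  have hconst : ∀ c : ℝ, Tendsto (fun n : ℕ => c / n) atTop (𝓝 0) := fun c =>
    tendsto_const_div_atTop_nhds_zero_nat c
  have hd := departureEpoch_strictMono x hs
  refine tendsto_div_of_tendsto_epochs (F := fun N => ∫ t in (0 : ℝ)..(N : ℝ),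
    ageOfInformation x s t) ?_ ?_ hd hm ?_ ?_
  · exact fun i j hij => integral_age_mono x s (by positivity) (by exact_mod_cast hij)
  · exact fun n => intervalIntegral.integral_nonneg (by positivity)
      fun t ht => ageOfInformation_nonneg x s ht.1
  · simp only [integral_age_departureEpoch x hs]
    have h := (((hconst ((departureEpoch x s 0 : ℝ) ^ 2 / 2)).add hxT).add
      (hT.div_const 2)).add (hconst (-(systemTime x s 0 : ℝ) ^ 2 / 2))
    simp only [zero_add, zero_div, add_zero] at h
    refine h.congr fun n => ?_
    ring
  · have hT1 : Tendsto (fun n : ℕ => (systemTime x s n : ℝ) / n) atTop (𝓝 0) := by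
      refine squeeze_zero (fun n => by positivity) (fun n => ?_) hT
      refine div_le_div_of_nonneg_right ?_ (by positivity)
      exact_mod_cast Nat.le_self_pow two_ne_zero _
    have hx1 : Tendsto (fun n : ℕ => (arrivalEpoch x n : ℝ) / n) atTop (𝓝 m) := by
      have h := (hx.comp (tendsto_add_atTop_nat 1)).mul
        ((tendsto_const_nhds (x := (1 : ℝ))).add tendsto_one_div_atTop_nhds_zero_nat)
      simp only [add_zero, mul_one] at h
      refine h.congr' ?_
      filter_upwards [eventually_gt_atTop 0] with n hn
      have : (n : ℝ) ≠ 0 := by positivity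
      have : ((n + 1 : ℕ) : ℝ) ≠ 0 := by positivity
      simp only [Function.comp, arrivalEpoch]
      push_cast at *
      field_simp
    have h := hx1.add hT1
    simp only [add_zero] at h
    refine h.congr fun n => ?_
    simp only [departureEpoch]
    push_cast
    ring

/-! ### The Poisson equation of the system-time chain. -/

/-- The sub-Markov kernel of the waiting-time recursion, killed when the server idles, acting on
functions: `h ↦ (t ↦ E[h(t - X + S); X ≤ t])`, where `p` is the law of `(X, S)`. -/
noncomputable def busyKernel (p : Measure (ℕ × ℕ)) (h : ℕ → ENNReal) (t : ℕ) : ENNReal :=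
  ∫⁻ z, (if z.1 ≤ t then h (t - z.1 + z.2) else 0) ∂p

/-- On `X ≤ t` the truncated subtraction is genuine, so `r^(t - X + S) = r^t r^(S - X)`, and the
drift contracts the weight `r^t` by `γ`. -/
theorem busyKernel_le (p : Measure (ℕ × ℕ)) {r γ : ℝ} (hr : 1 < r)
    (hdrift : ∫⁻ z, ENNReal.ofReal (r ^ z.2 * r⁻¹ ^ z.1) ∂p ≤ ENNReal.ofReal γ)
    {h : ℕ → ENNReal} {C : ENNReal} (hh : ∀ t, h t ≤ C * ENNReal.ofReal (r ^ t)) (t : ℕ) :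
    busyKernel p h t ≤ C * ENNReal.ofReal γ * ENNReal.ofReal (r ^ t) := by
  have hr0 : 0 < r := by linarith
  calc busyKernel p h t
      ≤ ∫⁻ z, C * ENNReal.ofReal (r ^ t) * ENNReal.ofReal (r ^ z.2 * r⁻¹ ^ z.1) ∂p := by
        refine lintegral_mono fun z => ?_
        dsimp only
        split_ifs with hz
        · refine (hh _).trans (le_of_eq ?_)
          rw [mul_assoc, ← ENNReal.ofReal_mul (by positivity)]
          congr 2
          obtain ⟨d, rfl⟩ := Nat.exists_eq_add_of_le hz
          rw [Nat.add_sub_cancel_left, pow_add, pow_add, inv_pow]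
          field_simp
        · exact zero_le
    _ = C * ENNReal.ofReal (r ^ t) * ∫⁻ z, ENNReal.ofReal (r ^ z.2 * r⁻¹ ^ z.1) ∂p :=
        lintegral_const_mul _ .of_discrete
    _ ≤ C * ENNReal.ofReal (r ^ t) * ENNReal.ofReal γ := by gcongr
    _ = _ := by ring

theorem busyKernel_tsum (p : Measure (ℕ × ℕ)) (f : ℕ → ℕ → ENNReal) (t : ℕ) :
    busyKernel p (fun u => ∑' k, f k u) t = ∑' k, busyKernel p (f k) t := by
  unfold busyKernel
  rw [← lintegral_tsum fun k => Measurable.of_discrete.aemeasurable]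
  refine lintegral_congr fun z => ?_
  split_ifs <;> simp

/-- The Neumann series `∑ Bᵏ c` of the kernel `B` is dominated by a geometric series in `γ` in the
weighted norm. -/
theorem exists_busyKernel_resolvent (p : Measure (ℕ × ℕ)) {r γ : ℝ} (hr : 1 < r)
    (hγ1 : γ < 1)
    (hdrift : ∫⁻ z, ENNReal.ofReal (r ^ z.2 * r⁻¹ ^ z.1) ∂p ≤ ENNReal.ofReal γ)
    (c : ℕ → ENNReal) {C : ENNReal} (hC : C ≠ ⊤) (hc : ∀ t, c t ≤ C) :
    ∃ h : ℕ → ENNReal, ∃ K : ENNReal, K ≠ ⊤ ∧ (∀ t, h t ≤ K * ENNReal.ofReal (r ^ t)) ∧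
      ∀ t, h t = c t + busyKernel p h t := by
  have hiter : ∀ k t, (busyKernel p)^[k] c t
      ≤ C * ENNReal.ofReal γ ^ k * ENNReal.ofReal (r ^ t) := by
    intro k
    induction k with
    | zero =>
      intro t
      simp only [Function.iterate_zero, id, pow_zero, mul_one]
      refine (hc t).trans (le_mul_of_one_le_right zero_le ?_)
      rw [← ENNReal.ofReal_one]
      exact ENNReal.ofReal_le_ofReal (one_le_pow₀ hr.le)
    | succ k ih =>
      intro t
      rw [Function.iterate_succ_apply', pow_succ, ← mul_assoc]
      exact busyKernel_le p hr hdrift ih t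
  refine ⟨fun t => ∑' k, (busyKernel p)^[k] c t, C * (1 - ENNReal.ofReal γ)⁻¹, ?_, ?_, ?_⟩
  · refine ENNReal.mul_ne_top hC (ENNReal.inv_ne_top.2 ?_)
    rw [Ne, tsub_eq_zero_iff_le, not_le, ENNReal.ofReal_lt_one]
    exact hγ1
  · intro t
    refine (ENNReal.tsum_le_tsum fun k => hiter k t).trans (le_of_eq ?_)
    rw [ENNReal.tsum_mul_right, ENNReal.tsum_mul_left, ENNReal.tsum_geometric]
  · intro t
    rw [busyKernel_tsum]
    conv_lhs => dsimp only; rw [tsum_eq_zero_add' ENNReal.summable]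
    simp only [Function.iterate_zero, id, Function.iterate_succ_apply']

/-- Solution of the Poisson equation of the system-time chain, with the cost
`x * (t - x)`. -/
theorem exists_poisson_solution (p : Measure (ℕ × ℕ)) [IsProbabilityMeasure p] {r γ : ℝ}
    (hr : 1 < r) (hγ1 : γ < 1)
    (hdrift : ∫⁻ z, ENNReal.ofReal (r ^ z.2 * r⁻¹ ^ z.1) ∂p ≤ ENNReal.ofReal γ)
    (hX : Integrable (fun z : ℕ × ℕ => (z.1 : ℝ)) p)
    (hS : Integrable (fun z : ℕ × ℕ => r ^ z.2) p) :
    ∃ (H : ℕ → ℝ) (K y : ℝ), 0 ≤ y ∧ (∀ t, 0 ≤ H t) ∧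
      (∀ t, H t ≤ K * r ^ t) ∧ (∀ t : ℕ, Integrable
        (fun z : ℕ × ℕ => (z.1 : ℝ) * ((t - z.1 : ℕ) : ℝ) + H (t - z.1 + z.2)) p) ∧
      ∀ t : ℕ, ∫ z, ((z.1 : ℝ) * ((t - z.1 : ℕ) : ℝ) + H (t - z.1 + z.2)) ∂p = H t + y := by
  have hr0 : 0 < r := by linarith
  -- The difference `g(t) = H(t+1) - H(t)` is sought first. Since `(t+1-x)⁺ - (t-x)⁺` is the
  -- indicator of `x ≤ t`, differencing the Poisson equation removes `y` and gives `g(t) = E[X; X ≤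
  -- t] + (B g)(t)`, with `B` the busy kernel.
  obtain ⟨h, K, hK, hhK, hh⟩ := exists_busyKernel_resolvent p hr hγ1 hdrift
    (fun t => ∫⁻ z, (if z.1 ≤ t then (z.1 : ENNReal) else 0) ∂p)
    (C := ∫⁻ z, (z.1 : ENNReal) ∂p) (by
      have := hX.lintegral_lt_top.ne
      simpa using this) (fun t => lintegral_mono fun z => by dsimp only; split_ifs <;> simp)
  have hfin : ∀ t, h t ≠ ⊤ := fun t =>
    ((hhK t).trans_lt (ENNReal.mul_lt_top hK.lt_top ENNReal.ofReal_lt_top)).ne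
  set g : ℕ → ℝ := fun t => (h t).toReal with hg
  have hg0 : ∀ t, 0 ≤ g t := fun t => ENNReal.toReal_nonneg
  have hgK : ∀ t, g t ≤ K.toReal * r ^ t := fun t => by
    have := ENNReal.toReal_mono (ENNReal.mul_ne_top hK ENNReal.ofReal_ne_top) (hhK t)
    rwa [ENNReal.toReal_mul, ENNReal.toReal_ofReal (by positivity)] at this
  set H : ℕ → ℝ := fun t => ∑ i ∈ Finset.range t, g i with hH
  have hH0 : ∀ t, 0 ≤ H t := fun t => Finset.sum_nonneg fun i _ => hg0 i
  have hHK : ∀ t, H t ≤ K.toReal / (r - 1) * r ^ t := fun t => by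
    calc H t ≤ ∑ i ∈ Finset.range t, K.toReal * r ^ i := Finset.sum_le_sum fun i _ => hgK i
      _ = K.toReal * ((r ^ t - 1) / (r - 1)) := by
        rw [← Finset.mul_sum, geom_sum_eq hr.ne']
      _ ≤ K.toReal * (r ^ t / (r - 1)) := by
        have : 0 < r - 1 := by linarith
        gcongr
        linarith
      _ = _ := by ring
  have hintH : ∀ t, Integrable (fun z : ℕ × ℕ => H (t - z.1 + z.2)) p := fun t => by
    refine (hS.const_mul (K.toReal / (r - 1) * r ^ t)).mono'
      Measurable.of_discrete.aestronglyMeasurable (ae_of_all _ fun z => ?_)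
    rw [Real.norm_of_nonneg (hH0 _)]
    refine (hHK _).trans ?_
    rw [mul_assoc, ← pow_add]
    have : 0 < r - 1 := by linarith
    have := hr.le
    gcongr
    omega
  have hintX : ∀ t : ℕ, Integrable (fun z : ℕ × ℕ => (z.1 : ℝ) * ((t - z.1 : ℕ) : ℝ)) p :=
    fun t => by
    refine (hX.mul_const (t : ℝ)).mono'
      Measurable.of_discrete.aestronglyMeasurable (ae_of_all _ fun z => ?_)
    rw [Real.norm_of_nonneg (by positivity)]
    gcongr
    omega
  -- At `t = 0` the cost vanishes and `H 0 = 0`, which forces `y = E(H(S))`. The equation then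
  -- propagates from `t` to `t + 1` by the identity for `g`.
  refine ⟨H, K.toReal / (r - 1), ∫ z, H z.2 ∂p,
    integral_nonneg fun z => hH0 _, hH0, hHK,
    fun t => (hintX t).add (hintH t), fun t => ?_⟩
  induction t with
  | zero => simp [hH]
  | succ t ih =>
    have hstep : ∀ z : ℕ × ℕ, ((z.1 : ℝ) * ((t + 1 - z.1 : ℕ) : ℝ) + H (t + 1 - z.1 + z.2))
        - ((z.1 : ℝ) * ((t - z.1 : ℕ) : ℝ) + H (t - z.1 + z.2))
        = ((if z.1 ≤ t then (z.1 : ENNReal) else 0)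
          + (if z.1 ≤ t then h (t - z.1 + z.2) else 0)).toReal := by
      intro z
      split_ifs with hz
      · rw [ENNReal.toReal_add (by simp) (hfin _), show t + 1 - z.1 = t - z.1 + 1 by omega,
          show t - z.1 + 1 + z.2 = t - z.1 + z.2 + 1 by omega]
        simp only [hH, Finset.sum_range_succ, ENNReal.toReal_natCast]
        push_cast
        ring
      · rw [show t + 1 - z.1 = 0 by omega, show t - z.1 = 0 by omega]
        simp
    have hdiff : ∫ z, ((z.1 : ℝ) * ((t + 1 - z.1 : ℕ) : ℝ) + H (t + 1 - z.1 + z.2)) ∂p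
        - ∫ z, ((z.1 : ℝ) * ((t - z.1 : ℕ) : ℝ) + H (t - z.1 + z.2)) ∂p = g t := by
      have hint : ∀ u : ℕ, Integrable
          (fun z : ℕ × ℕ => (z.1 : ℝ) * ((u - z.1 : ℕ) : ℝ) + H (u - z.1 + z.2)) p :=
        fun u => (hintX u).add (hintH u)
      rw [← integral_sub (hint _) (hint _)]
      simp only [hstep]
      rw [integral_toReal Measurable.of_discrete.aemeasurable (ae_of_all _ fun z => ?_),
        lintegral_add_left .of_discrete]
      · simp only [hg]
        rw [hh t]
        rfl
      · split_ifs <;> simp [(hfin _).lt_top]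
    have : H (t + 1) = H t + g t := by simp [hH, Finset.sum_range_succ]
    linarith

/-! ### The geometric invariant law and the value of the Poisson constant. -/

/-- Expectation of `F` under the geometric law on `{1, 2, …}` with ratio `l`. -/
noncomputable def geoExpect (l : ℝ) (F : ℕ → ENNReal) : ENNReal :=
  ∑' n : ℕ, ENNReal.ofReal ((1 - l) * l ^ n) * F (n + 1)

theorem geoExpect_eq_add (l : ℝ) (F : ℕ → ENNReal) (hl : 0 ≤ l) :
    geoExpect l F = ENNReal.ofReal (1 - l) * F 1
      + ENNReal.ofReal l * geoExpect l (fun n => F (n + 1)) := by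
  unfold geoExpect
  rw [tsum_eq_zero_add' ENNReal.summable, ← ENNReal.tsum_mul_left]
  congr 1
  · simp
  · refine tsum_congr fun n => ?_
    rw [← mul_assoc, ← ENNReal.ofReal_mul hl]
    congr 2
    ring

theorem geoExpect_add (l : ℝ) (F G : ℕ → ENNReal) :
    geoExpect l (fun n => F n + G n) = geoExpect l F + geoExpect l G := by
  simp only [geoExpect, mul_add, ENNReal.tsum_add]

theorem geoExpect_const_mul (l : ℝ) (c : ENNReal) (F : ℕ → ENNReal) :
    geoExpect l (fun n => c * F n) = c * geoExpect l F := by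
  simp only [geoExpect, ← ENNReal.tsum_mul_left]
  exact tsum_congr fun n => by ring

theorem geoExpect_const {l : ℝ} (hl0 : 0 ≤ l) (hl1 : l < 1) (c : ENNReal) :
    geoExpect l (fun _ => c) = c := by
  unfold geoExpect
  rw [ENNReal.tsum_mul_right, ← ENNReal.ofReal_tsum_of_nonneg, tsum_mul_left,
    tsum_geometric_of_lt_one hl0 hl1, mul_inv_cancel₀ (by linarith)]
  · simp
  · intro n
    have : 0 ≤ 1 - l := by linarith
    positivity
  · exact (summable_geometric_of_lt_one hl0 hl1).mul_left _

theorem geoExpect_lintegral (l : ℝ) {β : Type*} [MeasurableSpace β] (ν : Measure β)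
    (F : ℕ → β → ENNReal) (hF : ∀ n, Measurable (F n)) :
    geoExpect l (fun n => ∫⁻ b, F n b ∂ν) = ∫⁻ b, geoExpect l (fun n => F n b) ∂ν := by
  unfold geoExpect
  rw [lintegral_tsum fun n => ((hF _).const_mul _).aemeasurable]
  exact tsum_congr fun n => (lintegral_const_mul _ (hF _)).symm

theorem geoExpect_pow {l r : ℝ} (hl1 : l < 1) (hl0 : 0 ≤ l) (hr : 0 ≤ r)
    (hlr : l * r < 1) :
    geoExpect l (fun n => ENNReal.ofReal (r ^ n)) = ENNReal.ofReal ((1 - l) * r / (1 - l * r)) := by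
  unfold geoExpect
  have h1 : 0 ≤ 1 - l := by linarith
  have hterm : ∀ n : ℕ, ENNReal.ofReal ((1 - l) * l ^ n) * ENNReal.ofReal (r ^ (n + 1))
      = ENNReal.ofReal ((1 - l) * r * (l * r) ^ n) := fun n => by
    rw [← ENNReal.ofReal_mul (by positivity)]
    congr 1
    ring
  simp only [hterm]
  rw [← ENNReal.ofReal_tsum_of_nonneg, tsum_mul_left,
    tsum_geometric_of_lt_one (by positivity) hlr, div_eq_mul_inv]
  · intro n; positivity
  · exact (summable_geometric_of_lt_one (by positivity) hlr).mul_left _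

theorem geoExpect_natCast {l : ℝ} (hl0 : 0 ≤ l) (hl1 : l < 1) :
    geoExpect l (fun n => (n : ENNReal)) = ENNReal.ofReal (1 / (1 - l)) := by
  unfold geoExpect
  have h1 : 0 < 1 - l := by linarith
  have hterm : ∀ n : ℕ, ENNReal.ofReal ((1 - l) * l ^ n) * ((n + 1 : ℕ) : ENNReal)
      = ENNReal.ofReal ((1 - l) * (n * l ^ n + l ^ n)) := fun n => by
    rw [← ENNReal.ofReal_natCast, ← ENNReal.ofReal_mul (by positivity)]
    congr 1
    push_cast
    ring
  have hn : ‖l‖ < 1 := by rwa [Real.norm_of_nonneg hl0]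
  have hs := ((hasSum_coe_mul_geometric_of_norm_lt_one hn).add
    (hasSum_geometric_of_lt_one hl0 hl1)).mul_left (1 - l)
  simp only [hterm]
  rw [← ENNReal.ofReal_tsum_of_nonneg (fun n => by positivity) hs.summable, hs.tsum_eq]
  congr 1
  field_simp
  ring

/-- Memorylessness: a geometric `N` exceeds `x` with probability `l^x`, and then `N - x` has the law
of `N`. -/
theorem geoExpect_sub_nat {l : ℝ} (hl0 : 0 ≤ l) (hl1 : l < 1) (F : ℕ → ENNReal) (x : ℕ) :
    geoExpect l (fun n => F (n - x))
      = ENNReal.ofReal (1 - l ^ x) * F 0 + ENNReal.ofReal (l ^ x) * geoExpect l F := by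
  induction x with
  | zero => simp
  | succ x ih =>
    have hlx : l ^ x ≤ 1 := pow_le_one₀ hl0 hl1.le
    rw [geoExpect_eq_add l _ hl0]
    simp only [Nat.add_sub_add_right, ih]
    rw [show 1 - (x + 1) = 0 by omega, mul_add, ← add_assoc, ← mul_assoc, ← mul_assoc,
      ← add_mul, ← ENNReal.ofReal_mul hl0, ← ENNReal.ofReal_mul hl0,
      ← ENNReal.ofReal_add (by linarith) (mul_nonneg hl0 (by linarith))]
    congr 3 <;> ring

/-- Stationary waiting time plus service: the waiting time is `0` with probability `1 - α` and
otherwise geometric with ratio `l`. Adding a geometric variable of ratio `q` returns ratio `l`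
exactly when the parameters are tied by `hl`. -/
theorem geoExpect_convolution {l q α : ℝ} (hq0 : 0 ≤ q) (hq1 : q ≤ 1) (hα0 : 0 ≤ α) (hα1 : α ≤ 1)
    (hl : l = q + (1 - q) * α) (f : ℕ → ENNReal) :
    ENNReal.ofReal (1 - α) * geoExpect q f
      + ENNReal.ofReal α * geoExpect l (fun w => geoExpect q (fun s => f (w + s)))
      = geoExpect l f := by
  have h1q : 0 ≤ 1 - q := by linarith
  have h1α : 0 ≤ 1 - α := by linarith
  have hl0 : 0 ≤ l := by rw [hl]; positivity
  have h1l : 1 - l = (1 - q) * (1 - α) := by rw [hl]; ring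
  have hl1 : 0 ≤ 1 - l := by rw [h1l]; positivity
  -- The double series is grouped by diagonals; the argument starts at `2` because both summands
  -- start at `1`.
  have hdouble : geoExpect l (fun w => geoExpect q (fun s => f (w + s)))
      = ∑' m : ℕ, ENNReal.ofReal ((1 - l) * (1 - q) *
          ∑ i ∈ Finset.range (m + 1), l ^ i * q ^ (m - i)) * f (m + 2) := by
    unfold geoExpect
    have h2 : ∀ n : ℕ, ENNReal.ofReal ((1 - l) * l ^ n) *
        ∑' j : ℕ, ENNReal.ofReal ((1 - q) * q ^ j) * f (n + 1 + (j + 1))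
        = ∑' j : ℕ, ENNReal.ofReal ((1 - l) * (1 - q) * (l ^ n * q ^ j)) * f (n + j + 2) := by
      intro n
      rw [← ENNReal.tsum_mul_left]
      refine tsum_congr fun j => ?_
      rw [← mul_assoc, ← ENNReal.ofReal_mul (by positivity)]
      congr 2
      · ring
      · ring
    simp only [h2]
    rw [← ENNReal.tsum_prod (f := fun n j : ℕ =>
        ENNReal.ofReal ((1 - l) * (1 - q) * (l ^ n * q ^ j)) * f (n + j + 2)),
      ← (Finset.HasAntidiagonal.sigmaAntidiagonalEquivProd (A := ℕ)).tsum_eq, ENNReal.tsum_sigma']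
    refine tsum_congr fun m => ?_
    rw [tsum_fintype,
      ← Finset.Nat.sum_antidiagonal_eq_sum_range_succ (fun i j => l ^ i * q ^ j),
      Finset.mul_sum, ENNReal.ofReal_sum_of_nonneg (fun i _ => by positivity), Finset.sum_mul,
      ← Finset.sum_coe_sort (Finset.HasAntidiagonal.antidiagonal m)]
    refine Finset.sum_congr rfl fun i _ => ?_
    have := Finset.HasAntidiagonal.mem_antidiagonal.1 i.2
    simp only [Finset.HasAntidiagonal.sigmaAntidiagonalEquivProd_apply]
    rw [this]
  rw [hdouble]
  unfold geoExpect
  rw [tsum_eq_zero_add' (f := fun n => ENNReal.ofReal ((1 - q) * q ^ n) * f (n + 1))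
      ENNReal.summable,
    tsum_eq_zero_add' (f := fun n => ENNReal.ofReal ((1 - l) * l ^ n) * f (n + 1))
      ENNReal.summable, mul_add, add_assoc, ← ENNReal.tsum_mul_left, ← ENNReal.tsum_mul_left,
    ← ENNReal.tsum_add]
  congr 1
  · rw [← mul_assoc, ← ENNReal.ofReal_mul h1α]
    congr 2
    rw [h1l]; ring
  · refine tsum_congr fun m => ?_
    have hsum : 0 ≤ ∑ i ∈ Finset.range (m + 1), l ^ i * q ^ (m - i) :=
      Finset.sum_nonneg fun i _ => by positivity
    rw [← mul_assoc, ← mul_assoc, ← ENNReal.ofReal_mul h1α, ← ENNReal.ofReal_mul hα0, ← add_mul,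
      ← ENNReal.ofReal_add (by positivity) (by positivity)]
    congr 2
    -- Multiplying the diagonal sum by `l - q = (1 - q) α` gives `l^(m+1) - q^(m+1)`; no division by
    -- `l - q` occurs.
    have hg := (Commute.all l q).geom_sum₂_mul (m + 1)
    simp only [Nat.add_sub_cancel] at hg
    have : l - q = (1 - q) * α := by rw [hl]; ring
    rw [this] at hg
    linear_combination (1 - α) * (1 - q) * hg
      + (α * (1 - q) * (∑ i ∈ Finset.range (m + 1), l ^ i * q ^ (m - i)) - l ^ (m + 1)) * h1l

/-- The geometric law with ratio `l` is invariant for the system-time recursion. -/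
theorem geoExpect_invariant {l q α : ℝ} (hq0 : 0 ≤ q) (hq1 : q ≤ 1) (hα0 : 0 ≤ α) (hα1 : α ≤ 1)
    (hl : l = q + (1 - q) * α) (hl1 : l < 1) (pX pS : Measure ℕ) [IsProbabilityMeasure pX]
    [IsProbabilityMeasure pS]
    (hpX : ∫⁻ x, ENNReal.ofReal (l ^ x) ∂pX = ENNReal.ofReal α)
    (hpS : ∀ F : ℕ → ENNReal, ∫⁻ s, F s ∂pS = geoExpect q F) (f : ℕ → ENNReal) :
    geoExpect l (fun t => ∫⁻ z, f (t - z.1 + z.2) ∂(pX.prod pS)) = geoExpect l f := by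
  have hl0 : 0 ≤ l := by
    have : 0 ≤ 1 - q := by linarith
    rw [hl]; positivity
  have hpX' : ∫⁻ x, ENNReal.ofReal (1 - l ^ x) ∂pX = ENNReal.ofReal (1 - α) := by
    have h : ∫⁻ x, (ENNReal.ofReal (1 - l ^ x) + ENNReal.ofReal (l ^ x)) ∂pX = 1 := by
      rw [show (1 : ENNReal) = ∫⁻ x, 1 ∂pX by simp]
      refine lintegral_congr fun x => ?_
      rw [← ENNReal.ofReal_add (by have := pow_le_one₀ hl0 hl1.le (n := x); linarith)
        (by positivity)]
      simp
    rw [lintegral_add_left .of_discrete, hpX] at h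
    rw [ENNReal.ofReal_sub _ hα0, ENNReal.ofReal_one, ← h,
      ENNReal.add_sub_cancel_right ENNReal.ofReal_ne_top]
  have hin : ∀ t : ℕ, ∫⁻ z, f (t - z.1 + z.2) ∂(pX.prod pS)
      = ∫⁻ x, geoExpect q (fun s => f (t - x + s)) ∂pX := fun t => by
    rw [lintegral_prod _ Measurable.of_discrete.aemeasurable]
    simp only [hpS]
  simp only [hin]
  rw [geoExpect_lintegral _ _ _ fun n => .of_discrete]
  simp only [fun x => geoExpect_sub_nat hl0 hl1 (fun w => geoExpect q fun s => f (w + s)) x]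
  rw [lintegral_add_left .of_discrete, lintegral_mul_const _ .of_discrete,
    lintegral_mul_const _ .of_discrete, hpX, hpX']
  simpa using geoExpect_convolution hq0 hq1 hα0 hα1 hl f

/-- Averaging the Poisson equation over the invariant law cancels `H`, whose mean is finite because
`l r < 1`. What remains is the stationary mean of `X (N - X)⁺`, computed by memorylessness. -/
theorem poisson_constant_eq {l q α : ℝ} (hq0 : 0 ≤ q) (hq1 : q ≤ 1) (hα0 : 0 ≤ α) (hα1 : α ≤ 1)
    (hl : l = q + (1 - q) * α) (hl1 : l < 1) (pX pS : Measure ℕ) [IsProbabilityMeasure pX]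
    [IsProbabilityMeasure pS]
    (hpX : ∫⁻ x, ENNReal.ofReal (l ^ x) ∂pX = ENNReal.ofReal α)
    (hpS : ∀ F : ℕ → ENNReal, ∫⁻ s, F s ∂pS = geoExpect q F)
    {r K y : ℝ} (hr : 0 ≤ r) (hlr : l * r < 1) (hy : 0 ≤ y) {H : ℕ → ℝ} (hH0 : ∀ t, 0 ≤ H t)
    (hHK : ∀ t, H t ≤ K * r ^ t)
    (hint : ∀ t : ℕ, Integrable (fun z : ℕ × ℕ =>
      (z.1 : ℝ) * ((t - z.1 : ℕ) : ℝ) + H (t - z.1 + z.2)) (pX.prod pS))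
    (hH : ∀ t : ℕ, ∫ z, ((z.1 : ℝ) * ((t - z.1 : ℕ) : ℝ) + H (t - z.1 + z.2)) ∂(pX.prod pS)
      = H t + y) :
    y = (∫ x, (x : ℝ) * l ^ x ∂pX) / (1 - l) := by
  have hl0 : 0 ≤ l := by
    have : 0 ≤ 1 - q := by linarith
    rw [hl]; positivity
  have h1l : 0 < 1 - l := by linarith
  have hfin : geoExpect l (fun t => ENNReal.ofReal (H t)) ≠ ⊤ := by
    have hle : geoExpect l (fun t => ENNReal.ofReal (H t))
        ≤ ENNReal.ofReal |K| * geoExpect l (fun t => ENNReal.ofReal (r ^ t)) := by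
      rw [← geoExpect_const_mul]
      refine ENNReal.tsum_le_tsum fun n => ?_
      gcongr
      dsimp only
      rw [← ENNReal.ofReal_mul (abs_nonneg K)]
      refine ENNReal.ofReal_le_ofReal ((hHK _).trans ?_)
      gcongr
      exact le_abs_self K
    rw [geoExpect_pow hl1 hl0 hr hlr] at hle
    exact (hle.trans_lt (ENNReal.mul_lt_top ENNReal.ofReal_lt_top ENNReal.ofReal_lt_top)).ne
  have hpoint : ∀ t : ℕ, ∫⁻ x, (x : ENNReal) * ((t - x : ℕ) : ENNReal) ∂pX
      + ∫⁻ z, ENNReal.ofReal (H (t - z.1 + z.2)) ∂(pX.prod pS)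
      = ENNReal.ofReal (H t) + ENNReal.ofReal y := by
    intro t
    have h := congrArg ENNReal.ofReal (hH t)
    rw [ofReal_integral_eq_lintegral_ofReal (hint t)
      (ae_of_all _ fun z => add_nonneg (by positivity) (hH0 _)),
      ENNReal.ofReal_add (hH0 t) hy] at h
    rw [← h]
    simp only [ENNReal.ofReal_add (mul_nonneg (Nat.cast_nonneg _) (Nat.cast_nonneg _)) (hH0 _)]
    rw [lintegral_add_left .of_discrete]
    congr 1
    rw [lintegral_prod _ Measurable.of_discrete.aemeasurable]
    simp [ENNReal.ofReal_mul]
  have hgeo : geoExpect l (fun t => ∫⁻ x, (x : ENNReal) * ((t - x : ℕ) : ENNReal) ∂pX)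
      = ENNReal.ofReal y := by
    have h := geoExpect_add l (fun t => ∫⁻ x, (x : ENNReal) * ((t - x : ℕ) : ENNReal) ∂pX)
      (fun t => ∫⁻ z, ENNReal.ofReal (H (t - z.1 + z.2)) ∂(pX.prod pS))
    simp only [hpoint] at h
    rw [geoExpect_add, geoExpect_const hl0 hl1,
      geoExpect_invariant hq0 hq1 hα0 hα1 hl hl1 pX pS hpX hpS (fun t => ENNReal.ofReal (H t)),
      add_comm] at h
    exact ((ENNReal.add_left_inj hfin).1 h).symm
  have hcost : geoExpect l (fun t => ∫⁻ x, (x : ENNReal) * ((t - x : ℕ) : ENNReal) ∂pX)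
      = ∫⁻ x, ENNReal.ofReal ((x : ℝ) * l ^ x / (1 - l)) ∂pX := by
    rw [geoExpect_lintegral _ _ _ fun n => .of_discrete]
    refine lintegral_congr fun x => ?_
    rw [geoExpect_const_mul, geoExpect_sub_nat hl0 hl1 (fun n => (n : ENNReal)),
      geoExpect_natCast hl0 hl1, Nat.cast_zero, mul_zero, zero_add, ← ENNReal.ofReal_natCast,
      ← ENNReal.ofReal_mul (by positivity), ← ENNReal.ofReal_mul (by positivity)]
    congr 1
    ring
  rw [← integral_div, integral_eq_lintegral_of_nonneg_ae
    (ae_of_all _ fun x => by dsimp only [Pi.zero_apply]; positivity)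
    Measurable.of_discrete.aestronglyMeasurable, ← hcost, hgeo,
    ENNReal.toReal_ofReal hy]

/-! ### Almost sure convergence from second moments. -/

/-- The squares have summable expectations, so they are almost surely summable. At `n = 0` the bound
is `0`, since `C / 0 = 0`; the sequences used below satisfy it by the same convention. -/
theorem ae_tendsto_zero_of_lintegral_sq_le {Ω : Type*} [MeasurableSpace Ω] {P : Measure Ω}
    {Z : ℕ → Ω → ℝ} (hZ : ∀ n, Measurable (Z n)) (C : ℝ)
    (h : ∀ n : ℕ, ∫⁻ ω, ENNReal.ofReal (Z n ω ^ 2) ∂P ≤ ENNReal.ofReal (C / (n : ℝ) ^ 2)) :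
    ∀ᵐ ω ∂P, Tendsto (fun n => Z n ω) atTop (𝓝 0) := by
  have hsum : ∫⁻ ω, ∑' n, ENNReal.ofReal (Z n ω ^ 2) ∂P ≠ ⊤ := by
    rw [lintegral_tsum fun n => ((hZ n).pow_const 2).ennreal_ofReal.aemeasurable]
    refine ((ENNReal.tsum_le_tsum h).trans_lt ?_).ne
    have hs : Summable fun n : ℕ => C / (n : ℝ) ^ 2 := by
      simpa [div_eq_mul_inv] using (Real.summable_nat_pow_inv.2 one_lt_two).mul_left C
    exact hs.tsum_ofReal_lt_top
  filter_upwards [ae_lt_top (.tsum fun n => ((hZ n).pow_const 2).ennreal_ofReal)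
    hsum] with ω hω
  have h1 := ENNReal.tendsto_atTop_zero_of_tsum_ne_top hω.ne
  have h2 := (ENNReal.tendsto_toReal ENNReal.zero_ne_top).comp h1
  have h3 : Tendsto (fun n => Z n ω ^ 2) atTop (𝓝 0) := by
    refine h2.congr fun n => ?_
    simp [ENNReal.toReal_ofReal (sq_nonneg (Z n ω))]
  have h4 := h3.sqrt
  simp only [Real.sqrt_sq_eq_abs, Real.sqrt_zero] at h4
  exact (tendsto_zero_iff_abs_tendsto_zero _).2 h4

/-- Consecutive squares have ratio tending to `1`, so monotonicity fills the gaps. -/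
theorem tendsto_div_of_tendsto_div_sq {u : ℕ → ℝ} (hu : Monotone u) {y : ℝ}
    (h : Tendsto (fun j : ℕ => u (j ^ 2) / (j : ℝ) ^ 2) atTop (𝓝 y)) :
    Tendsto (fun n : ℕ => u n / n) atTop (𝓝 y) := by
  refine tendsto_div_of_monotone_of_exists_subseq_tendsto_div u y hu fun a ha =>
    ⟨fun j => j ^ 2, ?_, tendsto_pow_atTop two_ne_zero, by simpa using h⟩
  have h1 : Tendsto (fun j : ℕ => (1 + 1 / (j : ℝ)) ^ 2) atTop (𝓝 1) := by
    simpa using ((tendsto_const_nhds (x := (1 : ℝ))).add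
      tendsto_one_div_atTop_nhds_zero_nat).pow 2
  filter_upwards [h1.eventually_le_const ha, eventually_gt_atTop 0] with j hj hj0
  have : (0 : ℝ) < j := by exact_mod_cast hj0
  calc (((j + 1) ^ 2 : ℕ) : ℝ) = (1 + 1 / (j : ℝ)) ^ 2 * (j : ℝ) ^ 2 := by
        push_cast; field_simp
    _ ≤ a * (j : ℝ) ^ 2 := by gcongr
    _ = _ := by push_cast; ring

/-! ### Independence of the past, and exponential moments of the system time. -/

/-- The information carried by the packets `0, …, k`. -/
abbrev packetPast {Ω : Type*} (X S : ℕ → Ω → ℕ) (k : ℕ) : MeasurableSpace Ω :=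
  ⨆ i ∈ {i : ℕ ⊕ ℕ | Sum.elim id id i ≤ k},
    MeasurableSpace.comap (Sum.elim X S i : Ω → ℕ) inferInstance

section
variable {Ω : Type*}

theorem measurable_packetPast (X S : ℕ → Ω → ℕ) {i : ℕ ⊕ ℕ} {k : ℕ}
    (hi : Sum.elim id id i ≤ k) :
    Measurable[packetPast X S k] (Sum.elim X S i : Ω → ℕ) := by
  refine Measurable.mono (comap_measurable _) ?_ le_rfl
  exact le_iSup₂_of_le (f := fun (i : ℕ ⊕ ℕ) (_ : i ∈ {i : ℕ ⊕ ℕ | Sum.elim id id i ≤ k}) =>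
    MeasurableSpace.comap (Sum.elim X S i : Ω → ℕ) inferInstance) i hi le_rfl

theorem packetPast_mono (X S : ℕ → Ω → ℕ) : Monotone (packetPast X S) := by
  intro j k hjk
  refine iSup₂_le fun i hi => ?_
  exact (measurable_packetPast X S (le_trans hi hjk)).comap_le

theorem measurable_systemTime_packetPast (X S : ℕ → Ω → ℕ) (k : ℕ) :
    Measurable[packetPast X S k]
      (fun ω => systemTime (fun i => X i ω) (fun i => S i ω) k) := by
  induction k with
  | zero => exact measurable_packetPast X S (i := .inr 0) le_rfl
  | succ k ih =>
    have h1 : Measurable[packetPast X S (k + 1)]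
        (fun ω => systemTime (fun i => X i ω) (fun i => S i ω) k) :=
      Measurable.mono ih (packetPast_mono X S (Nat.le_succ k)) le_rfl
    have h2 : Measurable[packetPast X S (k + 1)] (X (k + 1)) :=
      measurable_packetPast X S (i := .inl (k + 1)) le_rfl
    have h3 : Measurable[packetPast X S (k + 1)] (S (k + 1)) :=
      measurable_packetPast X S (i := .inr (k + 1)) le_rfl
    exact (h1.sub h2).add h3

variable [MeasurableSpace Ω] {P : Measure Ω} {X S : ℕ → Ω → ℕ}

theorem packetPast_le (hX : ∀ k, Measurable (X k)) (hS : ∀ k, Measurable (S k)) (k : ℕ) :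
    packetPast X S k ≤ ‹MeasurableSpace Ω› := by
  refine iSup₂_le fun i _ => ?_
  rcases i with i | i
  · exact (hX i).comap_le
  · exact (hS i).comap_le

theorem indepFun_of_measurable_packetPast (hX : ∀ k, Measurable (X k))
    (hS : ∀ k, Measurable (S k)) (hindep : iIndepFun (Sum.elim X S : ℕ ⊕ ℕ → Ω → ℕ) P)
    {β : Type*} [MeasurableSpace β] {k : ℕ} {f : Ω → β} (hf : Measurable[packetPast X S k] f) :
    IndepFun f (fun ω => (X (k + 1) ω, S (k + 1) ω)) P := by
  have h := indep_iSup_of_disjoint (μ := P)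
    (m := fun i : ℕ ⊕ ℕ => MeasurableSpace.comap (Sum.elim X S i : Ω → ℕ) inferInstance)
    (S := {i : ℕ ⊕ ℕ | Sum.elim id id i ≤ k}) (T := {i : ℕ ⊕ ℕ | k < Sum.elim id id i})
    (fun i => by
      rcases i with i | i
      · exact (hX i).comap_le
      · exact (hS i).comap_le) hindep
    (by
      rw [Set.disjoint_left]
      intro i hi hi'
      exact (not_le.2 (show k < Sum.elim id id i from hi')) hi)
  have hm : ∀ i : ℕ ⊕ ℕ, k < Sum.elim id id i → Measurable[⨆ i ∈ {i : ℕ ⊕ ℕ |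
      k < Sum.elim id id i}, MeasurableSpace.comap (Sum.elim X S i : Ω → ℕ) inferInstance]
      (Sum.elim X S i : Ω → ℕ) := by
    intro i hi
    refine Measurable.mono (comap_measurable _) ?_ le_rfl
    exact le_iSup₂_of_le (f := fun (i : ℕ ⊕ ℕ) (_ : i ∈ {i : ℕ ⊕ ℕ | k < Sum.elim id id i}) =>
      MeasurableSpace.comap (Sum.elim X S i : Ω → ℕ) inferInstance) i hi le_rfl
  rw [IndepFun_iff_Indep]
  refine indep_of_indep_of_le_left (indep_of_indep_of_le_right h ?_) hf.comap_le
  exact ((hm (.inl (k + 1)) (Nat.lt_succ_self k)).prodMk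
    (hm (.inr (k + 1)) (Nat.lt_succ_self k))).comap_le

/-- The pair `(Z, T_k)` is independent of packet `k + 1`, so Fubini integrates out the new packet
first, with `T_k` frozen. -/
theorem integral_mul_martingale_diff_eq_zero [IsProbabilityMeasure P]
    (hX : ∀ k, Measurable (X k)) (hS : ∀ k, Measurable (S k))
    (hindep : iIndepFun (Sum.elim X S : ℕ ⊕ ℕ → Ω → ℕ) P)
    {p : Measure (ℕ × ℕ)} (hlaw : ∀ k, P.map (fun ω => (X k ω, S k ω)) = p)
    {φ : ℕ → ℕ × ℕ → ℝ} (hφ : ∀ t, ∫ z, φ t z ∂p = 0) {k : ℕ} {Z : Ω → ℝ}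
    (hZ : Measurable[packetPast X S k] Z)
    (hint : Integrable (fun ω => Z ω * φ (systemTime (fun i => X i ω) (fun i => S i ω) k)
      (X (k + 1) ω, S (k + 1) ω)) P) :
    ∫ ω, Z ω * φ (systemTime (fun i => X i ω) (fun i => S i ω) k)
      (X (k + 1) ω, S (k + 1) ω) ∂P = 0 := by
  have hT := measurable_systemTime_packetPast X S k
  set T : Ω → ℕ := fun ω => systemTime (fun i => X i ω) (fun i => S i ω) k
  have hp : IsProbabilityMeasure p := by
    rw [← hlaw 0]
    exact Measure.isProbabilityMeasure_map ((hX 0).prodMk (hS 0)).aemeasurable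
  have hZT : Measurable[packetPast X S k] (fun ω => (Z ω, T ω)) := hZ.prodMk hT
  have hind := indepFun_of_measurable_packetPast hX hS hindep hZT
  have hZT' : Measurable (fun ω => (Z ω, T ω)) := hZT.mono (packetPast_le hX hS k) le_rfl
  have hXS : Measurable (fun ω => (X (k + 1) ω, S (k + 1) ω)) :=
    (hX _).prodMk (hS _)
  have hmap := (indepFun_iff_map_prod_eq_prod_map_map hZT'.aemeasurable hXS.aemeasurable).1 hind
  rw [hlaw (k + 1)] at hmap
  set Φ : (ℝ × ℕ) × (ℕ × ℕ) → ℝ := fun w => w.1.1 * φ w.1.2 w.2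
  have hΦ : Measurable Φ := by
    refine measurable_fst.fst.mul ?_
    exact (Measurable.of_discrete (f := fun v : ℕ × (ℕ × ℕ) => φ v.1 v.2)).comp
      (measurable_fst.snd.prodMk measurable_snd)
  have hmeas := hZT'.prodMk hXS
  have hint' : Integrable Φ ((P.map fun ω => (Z ω, T ω)).prod p) := by
    rw [← hmap, integrable_map_measure hΦ.aestronglyMeasurable hmeas.aemeasurable]
    exact hint
  have := Measure.isProbabilityMeasure_map (μ := P) hZT'.aemeasurable
  calc ∫ ω, Z ω * φ (T ω) (X (k + 1) ω, S (k + 1) ω) ∂P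
      = ∫ w, Φ w ∂((P.map fun ω => (Z ω, T ω)).prod p) := by
        rw [← hmap, integral_map hmeas.aemeasurable hΦ.aestronglyMeasurable]
    _ = 0 := by
        rw [integral_prod _ hint']
        simp [Φ, integral_const_mul, hφ]

/-- According to whether the server stays busy, `R^T_{k+1}` is at most `R^T_k R^(S-X)` or equal to
`R^S`. Hence the moments satisfy `m_{k+1} ≤ γ m_k + b`, and `b / (1 - γ)` is the fixed point. -/
theorem lintegral_pow_systemTime_le [IsProbabilityMeasure P]
    (hX : ∀ k, Measurable (X k)) (hS : ∀ k, Measurable (S k))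
    (hindep : iIndepFun (Sum.elim X S : ℕ ⊕ ℕ → Ω → ℕ) P)
    {p : Measure (ℕ × ℕ)} (hlaw : ∀ k, P.map (fun ω => (X k ω, S k ω)) = p)
    {R γ b : ℝ} (hR : 1 < R) (hγ0 : 0 ≤ γ) (hγ1 : γ < 1) (hb0 : 0 ≤ b)
    (hdrift : ∫⁻ z, ENNReal.ofReal (R ^ z.2 * R⁻¹ ^ z.1) ∂p ≤ ENNReal.ofReal γ)
    (hb : ∫⁻ z, ENNReal.ofReal (R ^ z.2) ∂p ≤ ENNReal.ofReal b) (k : ℕ) :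
    ∫⁻ ω, ENNReal.ofReal (R ^ systemTime (fun i => X i ω) (fun i => S i ω) k) ∂P
      ≤ ENNReal.ofReal (b / (1 - γ)) := by
  have hR0 : 0 < R := by linarith
  have h1γ : 0 < 1 - γ := by linarith
  have hXS : ∀ k, Measurable (fun ω => (X k ω, S k ω)) := fun k => (hX _).prodMk (hS _)
  have htr : ∀ (k : ℕ) (F : ℕ × ℕ → ENNReal),
      ∫⁻ ω, F (X k ω, S k ω) ∂P = ∫⁻ z, F z ∂p := fun k F => by
    rw [← hlaw k, lintegral_map .of_discrete (hXS k)]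
  induction k with
  | zero =>
    simp only [systemTime]
    rw [htr 0 (fun z => ENNReal.ofReal (R ^ z.2))]
    refine hb.trans (ENNReal.ofReal_le_ofReal ?_)
    rw [le_div_iff₀ h1γ]
    nlinarith
  | succ k ih =>
    have hT := measurable_systemTime_packetPast X S k
    have hT' := hT.mono (packetPast_le hX hS k) le_rfl
    have hind := (indepFun_of_measurable_packetPast hX hS hindep hT).comp
      (φ := fun t => ENNReal.ofReal (R ^ t))
      (ψ := fun z : ℕ × ℕ => ENNReal.ofReal (R ^ z.2 * R⁻¹ ^ z.1)) .of_discrete .of_discrete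
    have hbound : ∀ t x s : ℕ, ENNReal.ofReal (R ^ (t - x + s))
        ≤ ENNReal.ofReal (R ^ t) * ENNReal.ofReal (R ^ s * R⁻¹ ^ x) + ENNReal.ofReal (R ^ s) := by
      intro t x s
      rw [← ENNReal.ofReal_mul (by positivity), ← ENNReal.ofReal_add (by positivity)
        (by positivity)]
      refine ENNReal.ofReal_le_ofReal ?_
      rcases le_total x t with h | h
      · obtain ⟨d, rfl⟩ := Nat.exists_eq_add_of_le h
        have : R ^ (x + d) * (R ^ s * R⁻¹ ^ x) = R ^ (d + s) := by
          rw [pow_add, pow_add, inv_pow]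
          field_simp
        rw [this, Nat.add_sub_cancel_left]
        have : 0 ≤ R ^ s := by positivity
        linarith
      · rw [Nat.sub_eq_zero_of_le h, zero_add]
        have : 0 ≤ R ^ t * (R ^ s * R⁻¹ ^ x) := by positivity
        linarith
    calc ∫⁻ ω, ENNReal.ofReal (R ^ systemTime (fun i => X i ω) (fun i => S i ω) (k + 1)) ∂P
        ≤ ∫⁻ ω, (ENNReal.ofReal (R ^ systemTime (fun i => X i ω) (fun i => S i ω) k)
            * ENNReal.ofReal (R ^ S (k + 1) ω * R⁻¹ ^ X (k + 1) ω)
            + ENNReal.ofReal (R ^ S (k + 1) ω)) ∂P := lintegral_mono fun ω => hbound _ _ _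
      _ = (∫⁻ ω, ENNReal.ofReal (R ^ systemTime (fun i => X i ω) (fun i => S i ω) k) ∂P)
            * (∫⁻ z, ENNReal.ofReal (R ^ z.2 * R⁻¹ ^ z.1) ∂p)
            + ∫⁻ z, ENNReal.ofReal (R ^ z.2) ∂p := by
          have hm : Measurable fun ω => ENNReal.ofReal (R ^ S (k + 1) ω) :=
            (Measurable.of_discrete (f := fun s : ℕ => ENNReal.ofReal (R ^ s))).comp (hS (k + 1))
          rw [lintegral_add_right _ hm,
            ← htr (k + 1) (fun z => ENNReal.ofReal (R ^ z.2)),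
            ← htr (k + 1) (fun z => ENNReal.ofReal (R ^ z.2 * R⁻¹ ^ z.1))]
          congr 1
          exact lintegral_mul_eq_lintegral_mul_lintegral_of_indepFun
            ((Measurable.of_discrete (f := fun t : ℕ => ENNReal.ofReal (R ^ t))).comp hT')
            ((Measurable.of_discrete (f := fun z : ℕ × ℕ =>
              ENNReal.ofReal (R ^ z.2 * R⁻¹ ^ z.1))).comp (hXS (k + 1))) hind
      _ ≤ ENNReal.ofReal (b / (1 - γ)) * ENNReal.ofReal γ + ENNReal.ofReal b := by gcongr
      _ = ENNReal.ofReal (b / (1 - γ)) := by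
          rw [← ENNReal.ofReal_mul (by positivity), ← ENNReal.ofReal_add (by positivity) hb0]
          congr 1
          field_simp
          ring

end

/-! ### The ergodic theorem for the system-time chain. -/

theorem exists_pow_le_mul_pow (n : ℕ) {r : ℝ} (hr : 1 < r) :
    ∃ c : ℝ, 0 ≤ c ∧ ∀ t : ℕ, (t : ℝ) ^ n ≤ c * r ^ t := by
  obtain ⟨c, hc⟩ := (tendsto_pow_const_div_const_pow_of_one_lt n hr).bddAbove_range
  have h : ∀ t : ℕ, (t : ℝ) ^ n / r ^ t ≤ c := fun t => hc ⟨t, rfl⟩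
  have hr0 : 0 < r := by linarith
  refine ⟨c, le_trans (by positivity) (h 0), fun t => ?_⟩
  exact (div_le_iff₀ (by positivity)).1 (h t)

section
variable {Ω : Type*} [MeasurableSpace Ω] {P : Measure Ω} {X S : ℕ → Ω → ℕ}

/-- Second-moment bound for an additive functional of the system-time chain which is a martingale
with square-integrable increments. -/
theorem memLp_and_integral_sq_sum_le [IsProbabilityMeasure P]
    (hX : ∀ k, Measurable (X k)) (hS : ∀ k, Measurable (S k))
    (hindep : iIndepFun (Sum.elim X S : ℕ ⊕ ℕ → Ω → ℕ) P)
    {p : Measure (ℕ × ℕ)} (hlaw : ∀ k, P.map (fun ω => (X k ω, S k ω)) = p)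
    {φ : ℕ → ℕ × ℕ → ℝ} (hφ : ∀ t, ∫ z, φ t z ∂p = 0) {C : ℝ}
    (hL2 : ∀ k, MemLp (fun ω => φ (systemTime (fun i => X i ω) (fun i => S i ω) k)
      (X (k + 1) ω, S (k + 1) ω)) 2 P)
    (hC : ∀ k, ∫ ω, φ (systemTime (fun i => X i ω) (fun i => S i ω) k)
      (X (k + 1) ω, S (k + 1) ω) ^ 2 ∂P ≤ C) (n : ℕ) :
    MemLp (fun ω => ∑ k ∈ Finset.range n, φ (systemTime (fun i => X i ω) (fun i => S i ω) k)
      (X (k + 1) ω, S (k + 1) ω)) 2 P ∧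
    ∫ ω, (∑ k ∈ Finset.range n, φ (systemTime (fun i => X i ω) (fun i => S i ω) k)
      (X (k + 1) ω, S (k + 1) ω)) ^ 2 ∂P ≤ C * n := by
  set D : ℕ → Ω → ℝ := fun k ω => φ (systemTime (fun i => X i ω) (fun i => S i ω) k)
      (X (k + 1) ω, S (k + 1) ω)
  have hD : ∀ j k, j < k → Measurable[packetPast X S k] (D j) := by
    intro j k hjk
    have h1 : Measurable[packetPast X S k]
        (fun ω => (systemTime (fun i => X i ω) (fun i => S i ω) j, (X (j + 1) ω, S (j + 1) ω))) :=
      (Measurable.mono (measurable_systemTime_packetPast X S j) (packetPast_mono X S hjk.le)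
        le_rfl).prodMk ((measurable_packetPast X S (i := .inl (j + 1)) hjk).prodMk
          (measurable_packetPast X S (i := .inr (j + 1)) hjk))
    exact (Measurable.of_discrete (f := fun v : ℕ × (ℕ × ℕ) => φ v.1 v.2)).comp h1
  change MemLp (fun ω => ∑ k ∈ Finset.range n, D k ω) 2 P ∧
    ∫ ω, (∑ k ∈ Finset.range n, D k ω) ^ 2 ∂P ≤ C * n
  induction n with
  | zero => simp
  | succ n ih =>
    obtain ⟨ih1, ih2⟩ := ih
    have hM : Measurable[packetPast X S n] (fun ω => ∑ k ∈ Finset.range n, D k ω) :=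
      Finset.measurable_fun_sum _ fun k hk => hD k n (Finset.mem_range.1 hk)
    have hint : Integrable (fun ω => (∑ k ∈ Finset.range n, D k ω) * D n ω) P :=
      ih1.integrable_mul (hL2 n)
    have hsqD : Integrable (fun ω => D n ω ^ 2) P := (hL2 n).integrable_sq
    have hsqM : Integrable (fun ω => (∑ k ∈ Finset.range n, D k ω) ^ 2) P := ih1.integrable_sq
    have hsum : Integrable (fun ω => (∑ k ∈ Finset.range n, D k ω) ^ 2
        + 2 * ((∑ k ∈ Finset.range n, D k ω) * D n ω)) P := hsqM.add (hint.const_mul 2)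
    have hcross : ∫ ω, (∑ k ∈ Finset.range n, D k ω) * D n ω ∂P = 0 := integral_mul_martingale_diff_eq_zero hX hS hindep hlaw hφ hM hint
    simp only [Finset.sum_range_succ]
    refine ⟨ih1.add (hL2 n), ?_⟩
    have he : ∀ ω, (∑ k ∈ Finset.range n, D k ω + D n ω) ^ 2
        = (∑ k ∈ Finset.range n, D k ω) ^ 2 + 2 * ((∑ k ∈ Finset.range n, D k ω) * D n ω)
          + D n ω ^ 2 := fun ω => by ring
    simp only [he]
    rw [integral_add hsum hsqD, integral_add hsqM (hint.const_mul 2), integral_const_mul, hcross]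
    have : ∫ ω, D n ω ^ 2 ∂P ≤ C := hC n
    push_cast
    linarith

set_option maxHeartbeats 1000000 in
-- The drift is assumed at rate `r²` because `H` grows like `r^t` and its square must be integrable
-- along the chain.
theorem ae_tendsto_of_poisson [IsProbabilityMeasure P]
    (hX : ∀ k, Measurable (X k)) (hS : ∀ k, Measurable (S k))
    (hindep : iIndepFun (Sum.elim X S : ℕ ⊕ ℕ → Ω → ℕ) P)
    {p : Measure (ℕ × ℕ)} (hlaw : ∀ k, P.map (fun ω => (X k ω, S k ω)) = p)
    {r γ b : ℝ} (hr : 1 < r) (hγ0 : 0 ≤ γ) (hγ1 : γ < 1) (hb0 : 0 ≤ b)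
    (hdrift : ∫⁻ z, ENNReal.ofReal ((r ^ 2) ^ z.2 * (r ^ 2)⁻¹ ^ z.1) ∂p ≤ ENNReal.ofReal γ)
    (hb : ∫⁻ z, ENNReal.ofReal ((r ^ 2) ^ z.2) ∂p ≤ ENNReal.ofReal b)
    {H : ℕ → ℝ} {K y : ℝ} (hy : 0 ≤ y) (hH0 : ∀ t, 0 ≤ H t) (hHK : ∀ t, H t ≤ K * r ^ t)
    (hHint : ∀ t : ℕ, Integrable (fun z : ℕ × ℕ =>
      (z.1 : ℝ) * ((t - z.1 : ℕ) : ℝ) + H (t - z.1 + z.2)) p)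
    (hH : ∀ t : ℕ, ∫ z, ((z.1 : ℝ) * ((t - z.1 : ℕ) : ℝ) + H (t - z.1 + z.2)) ∂p = H t + y) :
    ∀ᵐ ω ∂P, Tendsto (fun n : ℕ => (∑ k ∈ Finset.range n, (X (k + 1) ω : ℝ)
        * ((systemTime (fun i => X i ω) (fun i => S i ω) k - X (k + 1) ω : ℕ) : ℝ)) / (n : ℝ))
        atTop (𝓝 y) ∧
      Tendsto (fun n : ℕ => (systemTime (fun i => X i ω) (fun i => S i ω) n : ℝ) ^ 2 / n)
        atTop (𝓝 0) := by
  have hr0 : 0 < r := by linarith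
  have hR : 1 < r ^ 2 := one_lt_pow₀ hr two_ne_zero
  have hXS : ∀ k, Measurable (fun ω => (X k ω, S k ω)) := fun k => (hX _).prodMk (hS _)
  have hp : IsProbabilityMeasure p := by
    rw [← hlaw 0]
    exact Measure.isProbabilityMeasure_map (hXS 0).aemeasurable
  have hK0 : 0 ≤ K := by simpa using (hH0 0).trans (hHK 0)
  set T : ℕ → Ω → ℕ := fun k ω => systemTime (fun i => X i ω) (fun i => S i ω) k with hTdef
  have hTm : ∀ k, Measurable (T k) := fun k =>
    (measurable_systemTime_packetPast X S k).mono (packetPast_le hX hS k) le_rfl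
  have hcomp : ∀ (f : ℕ → ℝ) k, Measurable fun ω => f (T k ω) := fun f k =>
    (Measurable.of_discrete (f := f)).comp (hTm k)
  set B := b / (1 - γ) with hB
  have hB0 : 0 ≤ B := div_nonneg hb0 (by linarith)
  have hTR : ∀ k, ∫⁻ ω, ENNReal.ofReal ((r ^ 2) ^ T k ω) ∂P ≤ ENNReal.ofReal B :=
    lintegral_pow_systemTime_le hX hS hindep hlaw hR hγ0 hγ1 hb0 hdrift hb
  have hTint : ∀ k, Integrable (fun ω => (r ^ 2) ^ T k ω) P := fun k =>
    (lintegral_ofReal_ne_top_iff_integrable (hcomp (fun t => (r ^ 2) ^ t) k).aestronglyMeasurable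
      (ae_of_all _ fun ω => by dsimp only [Pi.zero_apply]; positivity)).1
      ((hTR k).trans_lt ENNReal.ofReal_lt_top).ne
  have hTI : ∀ k, ∫ ω, (r ^ 2) ^ T k ω ∂P ≤ B := fun k => by
    rw [integral_eq_lintegral_of_nonneg_ae (ae_of_all _ fun ω => by
      dsimp only [Pi.zero_apply]; positivity)
      (hcomp (fun t => (r ^ 2) ^ t) k).aestronglyMeasurable]
    exact ENNReal.toReal_le_of_le_ofReal hB0 (hTR k)
  have hsqint : ∀ (f : ℕ → ℝ) (c : ℝ), (∀ t, |f t| ≤ c * r ^ t) → ∀ k,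
      ∫⁻ ω, ENNReal.ofReal (f (T k ω) ^ 2) ∂P ≤ ENNReal.ofReal (c ^ 2 * B) := by
    intro f c hf k
    calc ∫⁻ ω, ENNReal.ofReal (f (T k ω) ^ 2) ∂P
        ≤ ∫⁻ ω, ENNReal.ofReal (c ^ 2) * ENNReal.ofReal ((r ^ 2) ^ T k ω) ∂P := by
          refine lintegral_mono fun ω => ?_
          rw [← ENNReal.ofReal_mul (by positivity), ← pow_mul, mul_comm 2, pow_mul, ← mul_pow,
            ← sq_abs]
          exact ENNReal.ofReal_le_ofReal (pow_le_pow_left₀ (abs_nonneg _) (hf _) 2)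
      _ = ENNReal.ofReal (c ^ 2) * ∫⁻ ω, ENNReal.ofReal ((r ^ 2) ^ T k ω) ∂P :=
          lintegral_const_mul _ (hcomp (fun t => (r ^ 2) ^ t) k).ennreal_ofReal
      _ ≤ ENNReal.ofReal (c ^ 2) * ENNReal.ofReal B := by gcongr; exact hTR k
      _ = _ := (ENNReal.ofReal_mul (by positivity)).symm
  obtain ⟨c, hc0, hc⟩ := exists_pow_le_mul_pow 2 hr
  -- the martingale increments
  set φ : ℕ → ℕ × ℕ → ℝ := fun t z =>
    ((z.1 : ℝ) * ((t - z.1 : ℕ) : ℝ) + H (t - z.1 + z.2)) - (H t + y) with hφdef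
  have hφ : ∀ t, ∫ z, φ t z ∂p = 0 := fun t => by
    simp only [hφdef]
    rw [integral_sub (hHint t) (integrable_const _), hH t]
    simp
  set A := c + K + y with hA
  have hA0 : 0 ≤ A := by positivity
  have hr1 : ∀ t : ℕ, 1 ≤ r ^ t := fun t => one_le_pow₀ hr.le
  have hφle : ∀ t x s : ℕ, |φ t (x, s)| ≤ A * r ^ t + A * r ^ (t - x + s) := by
    intro t x s
    have h1 : (x : ℝ) * ((t - x : ℕ) : ℝ) ≤ c * r ^ t := by
      refine le_trans ?_ (hc t)
      rcases le_total x t with h | h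
      · rw [sq]; gcongr; omega
      · rw [Nat.sub_eq_zero_of_le h]; simp
    have h2 := hHK t
    have h3 := hHK (t - x + s)
    have h4 := hH0 t
    have h5 := hH0 (t - x + s)
    have h6 : 0 ≤ (x : ℝ) * ((t - x : ℕ) : ℝ) := by positivity
    have h7 : y ≤ y * r ^ t := le_mul_of_one_le_right hy (hr1 t)
    have h8 : 0 ≤ c * r ^ (t - x + s) := by positivity
    have h9 : 0 ≤ y * r ^ (t - x + s) := by positivity
    have h10 : 0 ≤ c * r ^ t := by positivity
    have h11 : 0 ≤ K * r ^ t := by positivity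
    have h12 : 0 ≤ K * r ^ (t - x + s) := by positivity
    rw [abs_le]
    simp only [hφdef, hA]
    constructor <;> linarith
  have hsq : ∀ k ω, φ (T k ω) (X (k + 1) ω, S (k + 1) ω) ^ 2
      ≤ 2 * A ^ 2 * (r ^ 2) ^ T k ω + 2 * A ^ 2 * (r ^ 2) ^ T (k + 1) ω := by
    intro k ω
    have h := hφle (T k ω) (X (k + 1) ω) (S (k + 1) ω)
    have e : T (k + 1) ω = T k ω - X (k + 1) ω + S (k + 1) ω := rfl
    rw [← e] at h
    have h2 := pow_le_pow_left₀ (abs_nonneg _) h 2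
    rw [sq_abs] at h2
    have e2 : ∀ t : ℕ, (r ^ 2) ^ t = (r ^ t) ^ 2 := fun t => by rw [← pow_mul, ← pow_mul, mul_comm]
    rw [e2, e2]
    linarith [sq_nonneg (A * r ^ T k ω - A * r ^ T (k + 1) ω)]
  have hDm : ∀ k, Measurable fun ω => φ (T k ω) (X (k + 1) ω, S (k + 1) ω) := fun k =>
    (Measurable.of_discrete (f := fun v : ℕ × (ℕ × ℕ) => φ v.1 v.2)).comp
      ((hTm k).prodMk (hXS (k + 1)))
  have hdom : ∀ k, Integrable (fun ω => 2 * A ^ 2 * (r ^ 2) ^ T k ω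
      + 2 * A ^ 2 * (r ^ 2) ^ T (k + 1) ω) P := fun k =>
    ((hTint k).const_mul _).add ((hTint (k + 1)).const_mul _)
  have hDsq : ∀ k, Integrable (fun ω => φ (T k ω) (X (k + 1) ω, S (k + 1) ω) ^ 2) P := fun k =>
    (hdom k).mono' ((hDm k).pow_const 2).aestronglyMeasurable (ae_of_all _ fun ω => by
      rw [Real.norm_of_nonneg (sq_nonneg _)]; exact hsq k ω)
  -- The two terms of `hsq` contribute at most `2 A² B` each.
  have hmart := memLp_and_integral_sq_sum_le hX hS hindep hlaw hφ (C := 4 * A ^ 2 * B)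
    (fun k => (memLp_two_iff_integrable_sq (hDm k).aestronglyMeasurable).2 (hDsq k))
    (fun k => by
      refine (integral_mono (hDsq k) (hdom k) (hsq k)).trans ?_
      rw [integral_add ((hTint k).const_mul _) ((hTint (k + 1)).const_mul _),
        integral_const_mul, integral_const_mul]
      have h1 := hTI k
      have h2 := hTI (k + 1)
      have h3 : 0 ≤ 2 * A ^ 2 := by positivity
      nlinarith)
  have htele : ∀ n ω, ∑ k ∈ Finset.range n, φ (T k ω) (X (k + 1) ω, S (k + 1) ω)
      = (∑ k ∈ Finset.range n, (X (k + 1) ω : ℝ) * ((T k ω - X (k + 1) ω : ℕ) : ℝ))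
        + H (T n ω) - H (T 0 ω) - n * y := by
    intro n ω
    induction n with
    | zero => simp
    | succ n ih =>
      rw [Finset.sum_range_succ, ih, Finset.sum_range_succ]
      have e : T (n + 1) ω = T n ω - X (n + 1) ω + S (n + 1) ω := rfl
      simp only [hφdef]
      rw [← e]
      push_cast
      ring
  have hlimM := ae_tendsto_zero_of_lintegral_sq_le (P := P)
    (Z := fun j ω => (∑ k ∈ Finset.range (j ^ 2), φ (T k ω) (X (k + 1) ω, S (k + 1) ω))
      / (j : ℝ) ^ 2)
    (fun j => (Finset.measurable_fun_sum _ fun k _ => hDm k).div_const _) (4 * A ^ 2 * B)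
    (fun j => by
      rcases Nat.eq_zero_or_pos j with rfl | hj
      · simp
      obtain ⟨h1, h2⟩ := hmart (j ^ 2)
      have hj' : (0 : ℝ) < j := by exact_mod_cast hj
      simp only [div_pow]
      rw [← ofReal_integral_eq_lintegral_ofReal (h1.integrable_sq.div_const _)
        (ae_of_all _ fun ω => by dsimp only [Pi.zero_apply]; positivity), integral_div]
      refine ENNReal.ofReal_le_ofReal ?_
      rw [div_le_div_iff₀ (by positivity) (by positivity)]
      have h3 : (0 : ℝ) ≤ (j : ℝ) ^ 2 := by positivity
      calc _ ≤ 4 * A ^ 2 * B * ((j ^ 2 : ℕ) : ℝ) * (j : ℝ) ^ 2 :=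
            mul_le_mul_of_nonneg_right h2 h3
        _ = _ := by push_cast; ring)
  have hscale : ∀ (f : ℕ → ℝ) (a : ℝ), (∀ t, |f t| ≤ a * r ^ t) → ∀ n j : ℕ,
      ∫⁻ ω, ENNReal.ofReal ((f (T n ω) / j) ^ 2) ∂P ≤ ENNReal.ofReal (a ^ 2 * B / (j : ℝ) ^ 2) := by
    intro f a hf n j
    have h := hsqint (fun t => f t / j) (a / j) (fun t => by
      rw [abs_div, Nat.abs_cast, div_mul_eq_mul_div]
      exact div_le_div_of_nonneg_right (hf t) (by positivity)) n
    refine h.trans (le_of_eq ?_)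
    congr 1
    rw [div_pow]; ring
  -- Dividing by `j` alone already gives second moments of order `1 / j²`; the normalization by `j²`
  -- needed for the boundary term supplies a further factor `1 / j`.
  have hlimH := ae_tendsto_zero_of_lintegral_sq_le (P := P)
    (Z := fun j ω => H (T (j ^ 2) ω) / (j : ℝ))
    (fun j => (hcomp H _).div_const _) (K ^ 2 * B)
    (fun j => hscale H K (fun t => by rw [abs_of_nonneg (hH0 t)]; exact hHK t) _ j)
  have hlimT := ae_tendsto_zero_of_lintegral_sq_le (P := P)
    (Z := fun n ω => (T n ω : ℝ) ^ 2 / (n : ℝ))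
    (fun n => (hcomp (fun t => (t : ℝ) ^ 2) _).div_const _) (c ^ 2 * B)
    (fun n => hscale (fun t => (t : ℝ) ^ 2) c
      (fun t => by rw [abs_of_nonneg (by positivity)]; exact hc t) n n)
  filter_upwards [hlimM, hlimH, hlimT] with ω h1 h2 h3
  refine ⟨?_, h3⟩
  refine tendsto_div_of_tendsto_div_sq (u := fun n => ∑ k ∈ Finset.range n, (X (k + 1) ω : ℝ)
    * ((T k ω - X (k + 1) ω : ℕ) : ℝ)) ?_ ?_
  · refine monotone_nat_of_le_succ fun n => ?_
    rw [Finset.sum_range_succ]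
    have : 0 ≤ (X (n + 1) ω : ℝ) * ((T n ω - X (n + 1) ω : ℕ) : ℝ) := by positivity
    linarith
  · have h4 : Tendsto (fun j : ℕ => 1 / (j : ℝ)) atTop (𝓝 0) := tendsto_one_div_atTop_nhds_zero_nat
    have h5 := ((h1.sub (h2.mul h4)).add ((h4.mul h4).const_mul (H (T 0 ω)))).add_const y
    simp only [mul_zero, sub_zero, zero_add, add_zero] at h5
    refine h5.congr' ?_
    filter_upwards [eventually_gt_atTop 0] with j hj
    have : (j : ℝ) ≠ 0 := by positivity
    simp only [htele]
    push_cast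
    field_simp
    ring

end

/-! ### Generating function: the root and the strict inequalities. -/

section
variable {ν : Measure ℕ}

/-- Several of the comparisons below are equalities at `x = 1`, so strictness must come from the
mass on `x ≥ 2`. -/
theorem integral_lt_integral_of_two_le (hpos : ∀ᵐ x ∂ν, x ≠ 0) (h2 : ν {x | 2 ≤ x} ≠ 0)
    {f g : ℕ → ℝ} (hf : Integrable f ν) (hg : Integrable g ν)
    (hle : ∀ x, 1 ≤ x → f x ≤ g x) (hlt : ∀ x, 2 ≤ x → f x < g x) :
    ∫ x, f x ∂ν < ∫ x, g x ∂ν := by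
  have hae : 0 ≤ᵐ[ν] fun x => g x - f x := by
    filter_upwards [hpos] with x hx
    exact sub_nonneg.2 (hle x (Nat.one_le_iff_ne_zero.2 hx))
  have h := (integral_pos_iff_support_of_nonneg_ae hae (hg.sub hf)).2 (by
    refine lt_of_lt_of_le (pos_iff_ne_zero.2 h2) (measure_mono fun x hx => ?_)
    exact (sub_pos.2 (hlt x hx)).ne')
  rw [integral_sub hg hf] at h
  linarith

theorem measure_two_le_ne_zero [IsProbabilityMeasure ν]
    (hX : Integrable (fun x : ℕ => (x : ℝ)) ν)
    (hm : 1 < ∫ x, (x : ℝ) ∂ν) : ν {x : ℕ | 2 ≤ x} ≠ 0 := by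
  intro h
  have hae : ∀ᵐ (x : ℕ) ∂ν, (x : ℝ) ≤ 1 := by
    rw [ae_iff]
    convert h using 2
    ext x
    simp only [Set.mem_ofPred_eq, not_le]
    norm_cast
  have := integral_mono_ae hX (integrable_const (1 : ℝ)) hae
  simp at this
  linarith

/-- The chord slope `(1 - G(w)) / (1 - w) = E[1 + w + ⋯ + w ^ (X - 1)]` of the generating
function. -/
noncomputable def pgfChordSlope (ν : Measure ℕ) (w : ℝ) : ℝ :=
  ∫ x, (∑ i ∈ Finset.range x, w ^ i) ∂ν

theorem geom_sum_le_natCast {w : ℝ} (hw0 : 0 ≤ w) (hw1 : w ≤ 1) (x : ℕ) :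
    ∑ i ∈ Finset.range x, w ^ i ≤ x := by
  refine (Finset.sum_le_sum fun i _ => pow_le_one₀ hw0 hw1).trans ?_
  simp

theorem integrable_geom_sum (hX : Integrable (fun x : ℕ => (x : ℝ)) ν) {w : ℝ} (hw0 : 0 ≤ w)
    (hw1 : w ≤ 1) : Integrable (fun x : ℕ => ∑ i ∈ Finset.range x, w ^ i) ν :=
  hX.mono' Measurable.of_discrete.aestronglyMeasurable (ae_of_all _ fun x => by
    rw [Real.norm_of_nonneg (Finset.sum_nonneg fun i _ => by positivity)]
    exact geom_sum_le_natCast hw0 hw1 x)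

theorem integrable_pow_nat [IsFiniteMeasure ν] {w : ℝ} (hw0 : 0 ≤ w) (hw1 : w ≤ 1) :
    Integrable (fun x : ℕ => w ^ x) ν :=
  (integrable_const (1 : ℝ)).mono' Measurable.of_discrete.aestronglyMeasurable
    (ae_of_all _ fun x => by
      rw [Real.norm_of_nonneg (by positivity)]
      exact pow_le_one₀ hw0 hw1)

theorem integrable_mul_pow_nat (hX : Integrable (fun x : ℕ => (x : ℝ)) ν) {w : ℝ} (hw0 : 0 ≤ w)
    (hw1 : w ≤ 1) : Integrable (fun x : ℕ => (x : ℝ) * w ^ x) ν :=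
  hX.mono' Measurable.of_discrete.aestronglyMeasurable (ae_of_all _ fun x => by
    rw [Real.norm_of_nonneg (by positivity)]
    exact mul_le_of_le_one_right (Nat.cast_nonneg x) (pow_le_one₀ hw0 hw1))

theorem one_sub_mul_pgfChordSlope [IsProbabilityMeasure ν] {w : ℝ} (hw0 : 0 ≤ w) (hw1 : w ≤ 1) :
    (1 - w) * pgfChordSlope ν w = 1 - ∫ x, w ^ x ∂ν := by
  unfold pgfChordSlope
  rw [← integral_const_mul]
  simp only [mul_neg_geom_sum]
  rw [integral_sub (integrable_const _) (integrable_pow_nat hw0 hw1)]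
  simp

theorem pgfChordSlope_strictMonoOn (hpos : ∀ᵐ x ∂ν, x ≠ 0) (h2 : ν {x | 2 ≤ x} ≠ 0)
    (hX : Integrable (fun x : ℕ => (x : ℝ)) ν) :
    StrictMonoOn (pgfChordSlope ν) (Icc 0 1) := by
  intro v hv w hw hvw
  refine integral_lt_integral_of_two_le hpos h2 (integrable_geom_sum hX hv.1 hv.2)
    (integrable_geom_sum hX hw.1 hw.2) (fun x _ => ?_) fun x hx => ?_
  · have := hv.1
    gcongr
  · refine Finset.sum_lt_sum (fun i _ => pow_le_pow_left₀ hv.1 hvw.le i)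
      ⟨1, Finset.mem_range.2 (by omega), by simpa using hvw⟩

theorem pgfChordSlope_continuousOn (hX : Integrable (fun x : ℕ => (x : ℝ)) ν) :
    ContinuousOn (pgfChordSlope ν) (Icc 0 1) := by
  refine continuousOn_of_dominated (F := fun (w : ℝ) (x : ℕ) => ∑ i ∈ Finset.range x, w ^ i)
    (bound := fun x : ℕ => (x : ℝ))
    (fun w _ => Measurable.of_discrete.aestronglyMeasurable) (fun w hw => ae_of_all _ fun x => ?_)
    hX (ae_of_all _ fun x => by fun_prop)
  rw [Real.norm_of_nonneg (Finset.sum_nonneg fun i _ => pow_nonneg hw.1 i)]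
  exact geom_sum_le_natCast hw.1 hw.2 x

/-- The root of the generating function equation, in terms of `λ = 1 - μ + μ α`. -/
theorem exists_pgfChordSlope_eq [IsProbabilityMeasure ν] {μ : ℝ} (hμ0 : 0 < μ) (hμ1 : μ < 1)
    (hX : Integrable (fun x : ℕ => (x : ℝ)) ν)
    (hm : 1 < μ * ∫ x, (x : ℝ) ∂ν) :
    ∃ l ∈ Ioo (1 - μ) 1, μ * pgfChordSlope ν l = 1 := by
  -- At `w = 1 - μ` the factor `1 - w` is `μ`, so the left side equals `1 - G(1 - μ)`.
  have h0 : μ * pgfChordSlope ν (1 - μ) < 1 := by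
    have h := one_sub_mul_pgfChordSlope (ν := ν) (w := 1 - μ) (by linarith) (by linarith)
    rw [sub_sub_cancel] at h
    rw [h]
    have hp : 0 < ∫ x, (1 - μ) ^ x ∂ν := by
      rw [integral_pos_iff_support_of_nonneg (fun x => pow_nonneg (by linarith) x)
        (integrable_pow_nat (by linarith) (by linarith))]
      have : Function.support (fun x : ℕ => (1 - μ) ^ x) = Set.univ := by
        ext x
        simp only [Function.mem_support, Set.mem_univ, iff_true]
        exact pow_ne_zero _ (by linarith)
      rw [this]
      simp
    linarith
  have h1 : 1 < μ * pgfChordSlope ν 1 := by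
    simpa [pgfChordSlope] using hm
  have hc : ContinuousOn (fun w => μ * pgfChordSlope ν w) (Icc (1 - μ) 1) :=
    (continuousOn_const.mul (pgfChordSlope_continuousOn hX)).mono
      (Icc_subset_Icc_left (by linarith))
  obtain ⟨l, hl, hl'⟩ := intermediate_value_Ioo (by linarith) hc ⟨h0, h1⟩
  exact ⟨l, hl, hl'⟩

/-- With `w = 1 - μ + μ z` one has `1 - w = μ (1 - z)`; cancelling `1 - z` discards the trivial root
`z = 1`. -/
theorem pgf_eq_iff [IsProbabilityMeasure ν] {μ z : ℝ} (hμ0 : 0 < μ) (hμ1 : μ < 1)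
    (hz : z ∈ Ioo (0 : ℝ) 1) :
    z = ∫ x, ((1 - μ) + μ * z) ^ x ∂ν ↔ μ * pgfChordSlope ν ((1 - μ) + μ * z) = 1 := by
  have h := one_sub_mul_pgfChordSlope (ν := ν) (w := (1 - μ) + μ * z)
    (by have := mul_pos hμ0 hz.1; linarith) (by nlinarith [hz.2])
  have h1 : 1 - ((1 - μ) + μ * z) = μ * (1 - z) := by ring
  have h2 : 1 - z ≠ 0 := by linarith [hz.2]
  rw [h1] at h
  constructor
  · intro hz'
    rw [← hz'] at h
    apply mul_left_cancel₀ h2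
    linarith
  · intro hz'
    have : (1 - z) * (μ * pgfChordSlope ν ((1 - μ) + μ * z)) = 1 - z := by rw [hz', mul_one]
    linarith

/-- Each of the `x` copies of `l^x` is at most `l · l^i` with `i < x`. At the root the right side is
`λ/μ = λ E(S)`, which yields the upper bound through `E(S)`. -/
theorem integral_mul_pow_lt [IsProbabilityMeasure ν] (hpos : ∀ᵐ x ∂ν, x ≠ 0)
    (h2 : ν {x | 2 ≤ x} ≠ 0) (hX : Integrable (fun x : ℕ => (x : ℝ)) ν) {l : ℝ} (hl0 : 0 < l)
    (hl1 : l < 1) :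
    ∫ x, (x : ℝ) * l ^ x ∂ν < l * pgfChordSlope ν l := by
  unfold pgfChordSlope
  rw [← integral_const_mul]
  have hterm : ∀ x : ℕ, ∀ i ∈ Finset.range x, l ^ x ≤ l * l ^ i := fun x i hi => by
    rw [← pow_succ']
    exact pow_le_pow_of_le_one hl0.le hl1.le (Finset.mem_range.1 hi)
  refine integral_lt_integral_of_two_le hpos h2 (integrable_mul_pow_nat hX hl0.le hl1.le)
    ((integrable_geom_sum hX hl0.le hl1.le).const_mul l) (fun x _ => ?_) fun x hx => ?_
  · rw [Finset.mul_sum]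
    simpa using Finset.sum_le_sum (hterm x)
  · rw [Finset.mul_sum]
    have h := Finset.sum_lt_sum (hterm x) ⟨0, Finset.mem_range.2 (by omega), by
      simpa using pow_lt_self_of_lt_one₀ hl0 hl1 (by omega)⟩
    simpa using h

theorem integral_mul_pow_lt_mean (hpos : ∀ᵐ x ∂ν, x ≠ 0)
    (h2 : ν {x | 2 ≤ x} ≠ 0) (hX : Integrable (fun x : ℕ => (x : ℝ)) ν) {l : ℝ} (hl0 : 0 < l)
    (hl1 : l < 1) : ∫ x, (x : ℝ) * l ^ x ∂ν < ∫ x, (x : ℝ) ∂ν := by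
  refine integral_lt_integral_of_two_le hpos h2 (integrable_mul_pow_nat hX hl0.le hl1.le) hX
    (fun x _ => mul_le_of_le_one_right (Nat.cast_nonneg x) (pow_le_one₀ hl0.le hl1.le))
    fun x hx => mul_lt_of_lt_one_right (by positivity) (pow_lt_one₀ hl0.le hl1 (by omega))

theorem pgf_lt_integral_mul_pow [IsProbabilityMeasure ν] (hpos : ∀ᵐ x ∂ν, x ≠ 0)
    (h2 : ν {x | 2 ≤ x} ≠ 0) (hX : Integrable (fun x : ℕ => (x : ℝ)) ν) {l : ℝ} (hl0 : 0 < l)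
    (hl1 : l < 1) : ∫ x, l ^ x ∂ν < ∫ x, (x : ℝ) * l ^ x ∂ν := by
  refine integral_lt_integral_of_two_le hpos h2 (integrable_pow_nat hl0.le hl1.le)
    (integrable_mul_pow_nat hX hl0.le hl1.le) (fun x hx => ?_) fun x hx => ?_
  · exact le_mul_of_one_le_left (by positivity) (by exact_mod_cast hx)
  · exact lt_mul_of_one_lt_left (by positivity) (by exact_mod_cast hx)

/-- This is `1 + u < e^u` at `u = x log l`, multiplied by `x`. -/
theorem moment_expansion_lt_integral_mul_pow (hpos : ∀ᵐ x ∂ν, x ≠ 0)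
    (h2 : ν {x | 2 ≤ x} ≠ 0) (hX : Integrable (fun x : ℕ => (x : ℝ)) ν)
    (hX2 : Integrable (fun x : ℕ => (x : ℝ) ^ 2) ν) {l : ℝ} (hl0 : 0 < l) (hl1 : l < 1) :
    ∫ x, (x : ℝ) ∂ν + Real.log l * ∫ x, (x : ℝ) ^ 2 ∂ν < ∫ x, (x : ℝ) * l ^ x ∂ν := by
  rw [← integral_const_mul, ← integral_add hX (hX2.const_mul _)]
  have hlt : ∀ x : ℕ, 1 ≤ x → (x : ℝ) + Real.log l * (x : ℝ) ^ 2 < x * l ^ x := by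
    intro x hx
    have hx0 : (0 : ℝ) < x := by exact_mod_cast hx
    have h := Real.add_one_lt_exp (x := x * Real.log l)
      (mul_neg_of_pos_of_neg hx0 (Real.log_neg hl0 hl1)).ne
    rw [← Real.log_pow, Real.exp_log (by positivity), Real.log_pow] at h
    have := mul_lt_mul_of_pos_left h hx0
    linarith
  exact integral_lt_integral_of_two_le hpos h2 (hX.add (hX2.const_mul _))
    (integrable_mul_pow_nat hX hl0.le hl1.le) (fun x hx => (hlt x hx).le)
    fun x hx => hlt x (by omega)

end

/-! ### The service law and the geometric drift. -/

theorem lintegral_eq_geoExpect {ν : Measure ℕ} [IsProbabilityMeasure ν] {μ : ℝ} (hμ0 : 0 < μ)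
    (hμ1 : μ < 1) (hν : ∀ n, 1 ≤ n → ν.real {n} = (1 - μ) ^ (n - 1) * μ) (F : ℕ → ENNReal) :
    ∫⁻ s, F s ∂ν = geoExpect (1 - μ) F := by
  have hn : ∀ n : ℕ, ν {n + 1} = ENNReal.ofReal ((1 - (1 - μ)) * (1 - μ) ^ n) := fun n => by
    rw [← ENNReal.ofReal_toReal (measure_ne_top ν {n + 1})]
    congr 1
    have := hν (n + 1) (by omega)
    rw [measureReal_def] at this
    rw [this, Nat.add_sub_cancel]
    ring
  have hsplit : ∀ F : ℕ → ENNReal,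
      ∫⁻ s, F s ∂ν = F 0 * ν {0} + geoExpect (1 - μ) F := fun F => by
    rw [lintegral_countable', tsum_eq_zero_add' ENNReal.summable]
    congr 1
    exact tsum_congr fun n => by rw [hn, mul_comm]
  -- The masses on `n ≥ 1` already sum to `1`.
  have h0 : ν {0} = 0 := by
    have h := hsplit fun _ => 1
    rw [geoExpect_const (by linarith) (by linarith)] at h
    simp only [lintegral_const, measure_univ, one_mul] at h
    have h2 : 0 + (1 : ENNReal) = ν {0} + 1 := by rw [zero_add]; exact h
    exact ((ENNReal.add_left_inj ENNReal.one_ne_top).1 h2).symm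
  rw [hsplit, h0, mul_zero, zero_add]

theorem measure_ext_of_lintegral_nat {ν ν' : Measure ℕ}
    (h : ∀ F : ℕ → ENNReal, ∫⁻ s, F s ∂ν = ∫⁻ s, F s ∂ν') : ν = ν' :=
  Measure.ext_of_lintegral _ fun F _ => h F

theorem integral_natCast_of_geoExpect {ν : Measure ℕ} {q : ℝ} (hq0 : 0 ≤ q) (hq1 : q < 1)
    (hν : ∀ F : ℕ → ENNReal, ∫⁻ s, F s ∂ν = geoExpect q F) :
    Integrable (fun s : ℕ => (s : ℝ)) ν ∧ ∫ s, (s : ℝ) ∂ν = 1 / (1 - q) := by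
  have h : ∫⁻ s : ℕ, ENNReal.ofReal (s : ℝ) ∂ν = ENNReal.ofReal (1 / (1 - q)) := by
    simp only [ENNReal.ofReal_natCast]
    rw [hν, geoExpect_natCast hq0 hq1]
  constructor
  · refine (lintegral_ofReal_ne_top_iff_integrable Measurable.of_discrete.aestronglyMeasurable
      (ae_of_all _ fun s => Nat.cast_nonneg s)).1 ?_
    rw [h]
    exact ENNReal.ofReal_ne_top
  · rw [integral_eq_lintegral_of_nonneg_ae (ae_of_all _ fun s => Nat.cast_nonneg s)
      Measurable.of_discrete.aestronglyMeasurable, h, ENNReal.toReal_ofReal]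
    have : 0 < 1 - q := by linarith
    positivity

theorem ae_ne_zero_of_geoExpect {ν : Measure ℕ} {q : ℝ}
    (hν : ∀ F : ℕ → ENNReal, ∫⁻ s, F s ∂ν = geoExpect q F) : ∀ᵐ s ∂ν, s ≠ 0 := by
  rw [ae_iff]
  simp only [ne_eq, not_not]
  have h := hν (Set.indicator {s | s = 0} 1)
  rw [lintegral_indicator_one MeasurableSet.of_discrete] at h
  rw [h]
  simp [geoExpect]

/-- Geometric drift of the system-time chain: `E(r ^ (S - X)) < 1` for `1 < r < 1 / λ`. -/
theorem exists_drift {pX pS : Measure ℕ} [IsProbabilityMeasure pX] [IsProbabilityMeasure pS]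
    {μ l β : ℝ} (hμ0 : 0 < μ) (hμ1 : μ < 1)
    (hpS : ∀ F : ℕ → ENNReal, ∫⁻ s, F s ∂pS = geoExpect (1 - μ) F)
    (hpos : ∀ᵐ x ∂pX, x ≠ 0) (h2 : pX {x | 2 ≤ x} ≠ 0)
    (hX : Integrable (fun x : ℕ => (x : ℝ)) pX)
    (hl : l ∈ Ioo (1 - μ) 1) (hlslope : μ * pgfChordSlope pX l = 1) (hβ : β ∈ Ioo l 1) :
    (∃ γ, 0 ≤ γ ∧ γ < 1 ∧
      ∫⁻ z, ENNReal.ofReal (β⁻¹ ^ z.2 * (β⁻¹)⁻¹ ^ z.1) ∂(pX.prod pS) ≤ ENNReal.ofReal γ) ∧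
    ∃ b, 0 ≤ b ∧ ∫⁻ s, ENNReal.ofReal (β⁻¹ ^ s) ∂pS ≤ ENNReal.ofReal b := by
  have hq0 : 0 < 1 - μ := by linarith
  have hl0 : 0 < l := hq0.trans hl.1
  have hβ0 : 0 < β := hl0.trans hβ.1
  have hqβ : 1 - μ < β := hl.1.trans hβ.1
  have hdiff : 0 < β - (1 - μ) := by linarith
  have hgeo : ∫⁻ s, ENNReal.ofReal (β⁻¹ ^ s) ∂pS = ENNReal.ofReal (μ / (β - (1 - μ))) := by
    rw [hpS, geoExpect_pow (by linarith) hq0.le (by positivity)]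
    · congr 1
      have : 1 - (1 - μ) * β⁻¹ ≠ 0 := by
        have : 1 - (1 - μ) * β⁻¹ = (β - (1 - μ)) / β := by field_simp
        rw [this]
        positivity
      field_simp
      ring
    · rw [← div_eq_mul_inv, div_lt_one hβ0]
      exact hqβ
  refine ⟨⟨μ / (β - (1 - μ)) * ∫ x, β ^ x ∂pX, ?_, ?_, le_of_eq ?_⟩,
    ⟨_, by positivity, hgeo.le⟩⟩
  · exact mul_nonneg (by positivity) (integral_nonneg fun x => by positivity)
  -- The claim `μ G(β) < β - (1 - μ)` rearranges to `μ c(β) > 1` for the chord slope `c`, and `μ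
  -- c(l) = 1` with `c` strictly increasing.
  · have h1 := pgfChordSlope_strictMonoOn hpos h2 hX (a := l) (b := β) ⟨hl0.le, hl.2.le⟩
      ⟨hβ0.le, hβ.2.le⟩ hβ.1
    have h3 := one_sub_mul_pgfChordSlope (ν := pX) hβ0.le hβ.2.le
    have h4 : 1 < μ * pgfChordSlope pX β := by
      rw [← hlslope]
      exact mul_lt_mul_of_pos_left h1 hμ0
    have h5 : 0 < 1 - β := by linarith [hβ.2]
    rw [div_mul_eq_mul_div, div_lt_one hdiff]
    have h6 : (∫ x, β ^ x ∂pX) = 1 - (1 - β) * pgfChordSlope pX β := by linarith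
    rw [h6]
    nlinarith
  · rw [lintegral_prod _ Measurable.of_discrete.aemeasurable]
    have hin : ∀ x : ℕ, ∫⁻ s, ENNReal.ofReal (β⁻¹ ^ s * (β⁻¹)⁻¹ ^ x) ∂pS
        = ENNReal.ofReal (μ / (β - (1 - μ))) * ENNReal.ofReal (β ^ x) := fun x => by
      simp only [ENNReal.ofReal_mul (pow_nonneg (inv_nonneg.2 hβ0.le) _), inv_inv]
      rw [lintegral_mul_const _ .of_discrete, hgeo]
    simp only [hin]
    rw [lintegral_const_mul _ .of_discrete, ENNReal.ofReal_mul (by positivity),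
      ofReal_integral_eq_lintegral_ofReal (integrable_pow_nat hβ0.le hβ.2.le)
        (ae_of_all _ fun x => by dsimp only [Pi.zero_apply]; positivity)]

/-! ### The almost sure value of the average age. -/

section
variable {Ω : Type*} [MeasurableSpace Ω] {P : Measure Ω} {X S : ℕ → Ω → ℕ}

theorem ae_tendsto_average_packets (hX : ∀ k, Measurable (X k)) (hS : ∀ k, Measurable (S k))
    (hindep : iIndepFun (Sum.elim X S : ℕ ⊕ ℕ → Ω → ℕ) P)
    {p : Measure (ℕ × ℕ)} (hlaw : ∀ k, P.map (fun ω => (X k ω, S k ω)) = p)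
    {ψ : ℕ × ℕ → ℝ} (hψ : Integrable ψ p) (c : ℕ) :
    ∀ᵐ ω ∂P, Tendsto (fun n : ℕ => (∑ k ∈ Finset.range n, ψ (X (k + c) ω, S (k + c) ω)) / (n : ℝ))
      atTop (𝓝 (∫ z, ψ z ∂p)) := by
  have hXS : ∀ k, Measurable (fun ω => (X k ω, S k ω)) := fun k => (hX _).prodMk (hS _)
  have hψm : Measurable ψ := .of_discrete
  have hint : ∀ k, Integrable (fun ω => ψ (X k ω, S k ω)) P := fun k => by
    have := hψ
    rw [← hlaw k, integrable_map_measure hψm.aestronglyMeasurable (hXS k).aemeasurable] at this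
    exact this
  have hval : ∫ ω, ψ (X (0 + c) ω, S (0 + c) ω) ∂P = ∫ z, ψ z ∂p := by
    rw [← hlaw (0 + c), integral_map (hXS _).aemeasurable hψm.aestronglyMeasurable]
  rw [← hval]
  refine strong_law_ae_real (fun k ω => ψ (X (k + c) ω, S (k + c) ω)) (hint _) ?_ ?_
  · intro i j hij
    have hm : ∀ i : ℕ ⊕ ℕ, Measurable (Sum.elim X S i : Ω → ℕ) := by
      rintro (i | i)
      · exact hX i
      · exact hS i
    have h := hindep.indepFun_prodMk_prodMk hm (.inl (i + c)) (.inr (i + c)) (.inl (j + c))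
      (.inr (j + c)) (by simpa using hij) (by simp) (by simp) (by simpa using hij)
    exact h.comp hψm hψm
  · intro k
    have : IdentDistrib (fun ω => (X (k + c) ω, S (k + c) ω))
        (fun ω => (X (0 + c) ω, S (0 + c) ω)) P P :=
      ⟨(hXS _).aemeasurable, (hXS _).aemeasurable, by rw [hlaw, hlaw]⟩
    exact this.comp hψm

/-- The almost sure value of the average age. -/
theorem ae_hasAverageAge [IsProbabilityMeasure P] (hX : ∀ k, Measurable (X k)) (hS : ∀ k, Measurable (S k))
    (hindep : iIndepFun (Sum.elim X S : ℕ ⊕ ℕ → Ω → ℕ) P)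
    {pX pS : Measure ℕ} [IsProbabilityMeasure pX] [IsProbabilityMeasure pS]
    (hlaw : ∀ k, P.map (fun ω => (X k ω, S k ω)) = pX.prod pS)
    {μ α l : ℝ} (hμ0 : 0 < μ) (hμ1 : μ < 1)
    (hpS : ∀ F : ℕ → ENNReal, ∫⁻ s, F s ∂pS = geoExpect (1 - μ) F)
    (hpos : ∀ᵐ x ∂pX, x ≠ 0) (h2 : pX {x | 2 ≤ x} ≠ 0)
    (hX1 : Integrable (fun x : ℕ => (x : ℝ)) pX)
    (hX2 : Integrable (fun x : ℕ => (x : ℝ) ^ 2) pX)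
    (hm : 0 < ∫ x, (x : ℝ) ∂pX)
    (hα : α ∈ Ioo (0 : ℝ) 1) (hl : l = (1 - μ) + μ * α) (hG : ∫ x, l ^ x ∂pX = α)
    (hlslope : μ * pgfChordSlope pX l = 1) :
    ∀ᵐ ω ∂P, HasAverageAge (fun k => X k ω) (fun k => S k ω)
      ((∫ s, (s : ℝ) ∂pS) + (∫ x, (x : ℝ) ^ 2 ∂pX) / (2 * ∫ x, (x : ℝ) ∂pX)
        + (∫ x, (x : ℝ) * l ^ x ∂pX) / ((∫ x, (x : ℝ) ∂pX) * (1 - l))) := by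
  have hq0 : 0 < 1 - μ := by linarith
  have hμα := mul_pos hμ0 hα.1
  have hlI : l ∈ Ioo (1 - μ) 1 := ⟨by linarith, by nlinarith [hα.2]⟩
  have hl0 : 0 < l := hq0.trans hlI.1
  obtain ⟨hSint, -⟩ := integral_natCast_of_geoExpect hq0.le (by linarith) hpS
  -- the exponential rate
  set β : ℝ := √((l + 1) / 2) with hβdef
  have hβsq : β ^ 2 = (l + 1) / 2 := Real.sq_sqrt (by linarith)
  have hβ0 : 0 < β := Real.sqrt_pos.2 (by linarith)
  have hβ1 : β < 1 := by
    rw [hβdef, Real.sqrt_lt' one_pos]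
    linarith [hlI.2]
  -- Both `β` and `β²` must lie in `(l, 1)`: rate `β⁻¹` builds `H`, and rate `β⁻²` controls second
  -- moments. Hence `β²` is taken to be the midpoint.
  have hβ2I : β ^ 2 ∈ Ioo l 1 := by
    rw [hβsq]
    constructor <;> linarith [hlI.2]
  have hβI : β ∈ Ioo l 1 := ⟨by nlinarith [hβ2I.1], hβ1⟩
  have hr : 1 < β⁻¹ := (one_lt_inv₀ hβ0).2 hβ1
  obtain ⟨⟨γ, hγ0, hγ1, hγ⟩, b, hb0, hb⟩ := exists_drift hμ0 hμ1 hpS hpos h2 hX1 hlI hlslope hβI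
  obtain ⟨⟨γ', hγ0', hγ1', hγ'⟩, b', hb0', hb'⟩ :=
    exists_drift hμ0 hμ1 hpS hpos h2 hX1 hlI hlslope hβ2I
  rw [← inv_pow] at hγ' hb'
  have hb'' : ∫⁻ z : ℕ × ℕ, ENNReal.ofReal ((β⁻¹ ^ 2) ^ z.2) ∂(pX.prod pS)
      ≤ ENNReal.ofReal b' := by
    rw [lintegral_prod _ Measurable.of_discrete.aemeasurable]
    simpa using hb'
  have hSr : Integrable (fun s : ℕ => β⁻¹ ^ s) pS :=
    (lintegral_ofReal_ne_top_iff_integrable Measurable.of_discrete.aestronglyMeasurable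
      (ae_of_all _ fun s => by dsimp only [Pi.zero_apply]; positivity)).1
      (hb.trans_lt ENNReal.ofReal_lt_top).ne
  obtain ⟨H, K, y, hy, hH0, hHK, hHint, hH⟩ :=
    exists_poisson_solution (pX.prod pS) hr hγ1 hγ (hX1.comp_fst pS) (hSr.comp_snd pX)
  have hyval := poisson_constant_eq (α := α) hq0.le (by linarith) hα.1.le hα.2.le
    (by rw [hl]; ring) hlI.2 pX pS
    (by rw [← hG, ofReal_integral_eq_lintegral_ofReal (integrable_pow_nat hl0.le hlI.2.le)
        (ae_of_all _ fun x => by dsimp only [Pi.zero_apply]; positivity)])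
    hpS (inv_pos.2 hβ0).le (by rw [← div_eq_mul_inv, div_lt_one hβ0]; exact hβI.1)
    hy hH0 hHK hHint hH
  have hchain := ae_tendsto_of_poisson hX hS hindep hlaw hr hγ0' hγ1' hb0' hγ' hb'' hy hH0 hHK
    hHint hH
  have hint1 : Integrable (fun z : ℕ × ℕ => (z.1 : ℝ) * (z.2 : ℝ)) (pX.prod pS) :=
    hX1.mul_prod hSint
  have hint2 : Integrable (fun z : ℕ × ℕ => (z.1 : ℝ) ^ 2 / 2) (pX.prod pS) :=
    (hX2.div_const 2).comp_fst pS
  have hmean := ae_tendsto_average_packets hX hS hindep hlaw (hX1.comp_fst pS) 0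
  have hpair := ae_tendsto_average_packets hX hS hindep hlaw (hint1.add hint2) 1
  have hmean' : ∫ z : ℕ × ℕ, (z.1 : ℝ) ∂(pX.prod pS) = ∫ x, (x : ℝ) ∂pX := by
    rw [integral_fun_fst (fun x : ℕ => (x : ℝ))]
    simp
  have hpair' : ∫ z : ℕ × ℕ, ((z.1 : ℝ) * (z.2 : ℝ) + (z.1 : ℝ) ^ 2 / 2) ∂(pX.prod pS)
      = (∫ x, (x : ℝ) ∂pX) * (∫ s, (s : ℝ) ∂pS) + (∫ x, (x : ℝ) ^ 2 ∂pX) / 2 := by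
    rw [integral_add hint1 hint2, integral_prod_mul (fun x : ℕ => (x : ℝ)) (fun s : ℕ => (s : ℝ)),
      integral_fun_fst (fun x : ℕ => (x : ℝ) ^ 2 / 2)]
    simp [integral_div]
  have hSpos : ∀ᵐ ω ∂P, ∀ k, 1 ≤ S k ω := by
    rw [ae_all_iff]
    intro k
    have h : ∀ᵐ z ∂(pX.prod pS), z.2 ≠ 0 :=
      Measure.quasiMeasurePreserving_snd.ae (ae_ne_zero_of_geoExpect hpS)
    rw [← hlaw k] at h
    filter_upwards [ae_of_ae_map ((hX k).prodMk (hS k)).aemeasurable h] with ω hω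
    exact Nat.one_le_iff_ne_zero.2 hω
  filter_upwards [hchain, hmean, hpair, hSpos] with ω h1 h3 h4 h5
  -- Since `T_{k+1} = (T_k - X_{k+1})⁺ + S_{k+1}`, the area summand is the Poisson cost plus a
  -- function of the fresh packet `k + 1` alone, which explains the shift `1` in `hpair`.
  have h6 := h1.1.add h4
  have key := hasAverageAge_of_tendsto (x := fun k => X k ω) (s := fun k => S k ω) h5 hm
    (by rw [← hmean']; exact h3) h1.2
    (a := y + ∫ z : ℕ × ℕ, ((z.1 : ℝ) * (z.2 : ℝ) + (z.1 : ℝ) ^ 2 / 2) ∂(pX.prod pS)) (by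
      refine h6.congr fun n => ?_
      rw [← add_div, ← Finset.sum_add_distrib]
      congr 1
      refine Finset.sum_congr rfl fun k _ => ?_
      simp only [Pi.add_apply, systemTime]
      push_cast
      ring)
  convert key using 1
  rw [hpair', hyval]
  have h1l : 1 - l ≠ 0 := by linarith [hlI.2]
  have hm' := hm.ne'
  field_simp
  ring

end

/-! ### The main theorem. -/

theorem theorem3 {Ω : Type*} [MeasurableSpace Ω] (P : Measure Ω) [IsProbabilityMeasure P]
    (X S : ℕ → Ω → ℕ) (μ : ℝ) (hμ0 : 0 < μ) (hμ1 : μ < 1)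
    (hXmeas : ∀ k, Measurable (X k)) (hSmeas : ∀ k, Measurable (S k))
    -- all the inter-arrival times and service times are mutually independent
    (hindep : iIndepFun (Sum.elim X S : ℕ ⊕ ℕ → Ω → ℕ) P)
    -- the inter-arrival times are identically distributed, positive, with finite second moment
    (hXident : ∀ k, IdentDistrib (X k) (X 0) P P)
    (hXpos : ∀ᵐ ω ∂P, X 0 ω ≠ 0)
    (hXsq : Integrable (fun ω => (X 0 ω : ℝ) ^ 2) P)
    -- the service times are geometric with parameter `μ`
    (hSgeom : ∀ k n, 1 ≤ n → P.real {ω | S k ω = n} = (1 - μ) ^ (n - 1) * μ)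
    -- the traffic intensity is less than one
    (hρ : natMoment P (S 0) 1 / natMoment P (X 0) 1 < 1) :
    ∃ α ∈ Ioo (0 : ℝ) 1,
      (∀ z ∈ Ioo (0 : ℝ) 1, z = probGenFun P (X 0) ((1 - μ) + μ * z) ↔ z = α) ∧
      ∃ l : ℝ, l = (1 - μ) + μ * α ∧
      ∃ Δ : ℝ, (∀ᵐ ω ∂P, HasAverageAge (fun k => X k ω) (fun k => S k ω) Δ) ∧
        Δ < ageExpression P (X 0) (S 0) l
          (min (natMoment P (S 0) 1) (pgfDerivEstimate P (X 0) 1 l)) ∧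
        ageExpression P (X 0) (S 0) l
          (max (α / l) (pgfDerivEstimate P (X 0) 2 l)) < Δ := by
  set pX : Measure ℕ := P.map (X 0) with hpXdef
  set pS : Measure ℕ := P.map (S 0) with hpSdef
  have : IsProbabilityMeasure pX := Measure.isProbabilityMeasure_map (hXmeas 0).aemeasurable
  have : IsProbabilityMeasure pS := Measure.isProbabilityMeasure_map (hSmeas 0).aemeasurable
  have hgeo : ∀ k, ∀ F : ℕ → ENNReal, ∫⁻ s, F s ∂(P.map (S k)) = geoExpect (1 - μ) F := by
    intro k
    have := Measure.isProbabilityMeasure_map (μ := P) (hSmeas k).aemeasurable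
    refine lintegral_eq_geoExpect hμ0 hμ1 fun n hn => ?_
    rw [map_measureReal_apply (hSmeas k) .of_discrete]
    exact hSgeom k n hn
  have hpS := hgeo 0
  rw [← hpSdef] at hpS
  have hlaw : ∀ k, P.map (fun ω => (X k ω, S k ω)) = pX.prod pS := by
    intro k
    have hind : IndepFun (X k) (S k) P :=
      hindep.indepFun (i := .inl k) (j := .inr k) (by simp)
    rw [(indepFun_iff_map_prod_eq_prod_map_map (hXmeas k).aemeasurable
      (hSmeas k).aemeasurable).1 hind, (hXident k).map_eq]
    congr 1
    exact measure_ext_of_lintegral_nat fun F => by rw [hgeo k, hpS]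
  have hpos : ∀ᵐ x ∂pX, x ≠ 0 :=
    (ae_map_iff (hXmeas 0).aemeasurable .of_discrete).2 hXpos
  have hX2 : Integrable (fun x : ℕ => (x : ℝ) ^ 2) pX :=
    (integrable_map_measure Measurable.of_discrete.aestronglyMeasurable
      (hXmeas 0).aemeasurable).2 hXsq
  have hX1 : Integrable (fun x : ℕ => (x : ℝ)) pX :=
    hX2.mono' Measurable.of_discrete.aestronglyMeasurable (ae_of_all _ fun x => by
      rw [Real.norm_of_nonneg (Nat.cast_nonneg x)]
      exact_mod_cast Nat.le_self_pow two_ne_zero x)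
  have hmap : ∀ f : ℕ → ℝ, ∫ x, f x ∂pX = ∫ ω, f (X 0 ω) ∂P := fun f =>
    integral_map (hXmeas 0).aemeasurable Measurable.of_discrete.aestronglyMeasurable
  have hmapS : ∫ s, (s : ℝ) ∂pS = ∫ ω, (S 0 ω : ℝ) ∂P :=
    integral_map (hSmeas 0).aemeasurable Measurable.of_discrete.aestronglyMeasurable
  have hXm1 : natMoment P (X 0) 1 = ∫ x, (x : ℝ) ∂pX := by
    simp [natMoment, hmap fun x => (x : ℝ)]
  have hXm2 : natMoment P (X 0) 2 = ∫ x, (x : ℝ) ^ 2 ∂pX := by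
    simp [natMoment, hmap fun x => (x : ℝ) ^ 2]
  have hSm : natMoment P (S 0) 1 = ∫ s, (s : ℝ) ∂pS := by
    simp [natMoment, hmapS]
  have hpgf : ∀ z, probGenFun P (X 0) z = ∫ x, z ^ x ∂pX := fun z => (hmap _).symm
  have hSval : ∫ s, (s : ℝ) ∂pS = 1 / μ := by
    have := (integral_natCast_of_geoExpect (by linarith) (by linarith) hpS).2
    rwa [sub_sub_cancel] at this
  -- Positivity of the mean is needed before `ρ < 1` can be cleared of its denominator.
  have hm1 : 1 ≤ ∫ x, (x : ℝ) ∂pX := by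
    have h := integral_mono_ae (integrable_const (1 : ℝ)) hX1 (by
      filter_upwards [hpos] with x hx
      exact_mod_cast Nat.one_le_iff_ne_zero.2 hx)
    simpa using h
  have hm0 : 0 < ∫ x, (x : ℝ) ∂pX := by linarith
  have hμm : 1 < μ * ∫ x, (x : ℝ) ∂pX := by
    rw [hSm, hXm1, hSval, div_lt_one hm0, div_lt_iff₀ hμ0] at hρ
    linarith
  have hm : 1 < ∫ x, (x : ℝ) ∂pX := by nlinarith
  have h2 := measure_two_le_ne_zero hX1 hm
  obtain ⟨l, hl, hlslope⟩ := exists_pgfChordSlope_eq hμ0 hμ1 hX1 hμm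
  have hl0 : 0 < l := by linarith [hl.1]
  have h1l : 0 < 1 - l := by linarith [hl.2]
  set α : ℝ := (l - (1 - μ)) / μ with hαdef
  have hlα : l = (1 - μ) + μ * α := by rw [hαdef]; field_simp; ring
  have hα : α ∈ Ioo (0 : ℝ) 1 := by
    rw [hαdef]
    exact ⟨div_pos (by linarith [hl.1]) hμ0, (div_lt_one hμ0).2 (by linarith)⟩
  have hroot : ∀ z ∈ Ioo (0 : ℝ) 1, z = probGenFun P (X 0) ((1 - μ) + μ * z) ↔ z = α := by
    intro z hz
    rw [hpgf, pgf_eq_iff hμ0 hμ1 hz]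
    constructor
    · intro h
      have hw : (1 - μ) + μ * z ∈ Icc (0 : ℝ) 1 :=
        ⟨by have := mul_pos hμ0 hz.1; linarith, by nlinarith [hz.2]⟩
      have := (pgfChordSlope_strictMonoOn hpos h2 hX1).injOn hw ⟨hl0.le, hl.2.le⟩
        (mul_left_cancel₀ hμ0.ne' (h.trans hlslope.symm))
      rw [hαdef, ← this]
      field_simp
      ring
    · rintro rfl
      rw [← hlα]
      exact hlslope
  have hG : ∫ x, l ^ x ∂pX = α := by
    have := (hroot α hα).2 rfl
    rw [← hlα, hpgf] at this
    exact this.symm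
  refine ⟨α, hα, hroot, l, hlα, _, ae_hasAverageAge hXmeas hSmeas hindep hlaw hμ0 hμ1 hpS hpos h2
    hX1 hX2 hm0 hα hlα hG hlslope, ?_, ?_⟩
  · unfold ageExpression
    rw [hSm, hXm1, hXm2]
    gcongr
    rcases min_choice (∫ s, (s : ℝ) ∂pS) (pgfDerivEstimate P (X 0) 1 l) with h | h <;> rw [h]
    · refine (integral_mul_pow_lt hpos h2 hX1 hl0 hl.2).trans_eq ?_
      rw [hSval]
      congr 1
      field_simp
      linarith
    · refine (integral_mul_pow_lt_mean hpos h2 hX1 hl0 hl.2).trans_eq ?_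
      simp only [pgfDerivEstimate, Finset.Icc_self, Finset.sum_singleton, hXm1]
      field_simp
      simp
  · unfold ageExpression
    rw [hSm, hXm1, hXm2]
    gcongr
    rcases max_choice (α / l) (pgfDerivEstimate P (X 0) 2 l) with h | h <;> rw [h]
    · rw [mul_div_cancel₀ _ hl0.ne', ← hG]
      exact pgf_lt_integral_mul_pow hpos h2 hX1 hl0 hl.2
    · refine (Eq.trans_lt ?_ (moment_expansion_lt_integral_mul_pow hpos h2 hX1 hX2 hl0 hl.2))
      simp only [pgfDerivEstimate, Finset.sum_Icc_succ_top (show 1 ≤ 1 + 1 by norm_num),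
        Finset.Icc_self, Finset.sum_singleton, hXm1, hXm2]
      field_simp
      simp [mul_comm]
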